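/- Let $C$ be a field of characteristic $0$ and $S=C[s,t,\frac1{3s^2-1}]/(s^3-s-t^2)$, with the iterative derivation $\theta$ that extends the one by $t$ on $C[t]$; thus $\theta^{(n)}=\frac1{n!}\partial^n$, where $\partial$ is the $C$-derivation of $S$ with $\partial(t)=1$ and $\partial(s)=\frac{2t}{3s^2-1}$. Let $M$ be the $S$-module with generators $f_1,f_2$ and relations $tf_1=sf_2$, $(s^2-1)f_1=tf_2$, made into an ID-module by $\theta_M^{(n)}=\frac1{n!}\partial_M^n$, where $$\partial_M(f_1)=bf_1+\tfrac{3s^2+1}{3s^2-1}f_2,\qquad \partial_M(f_2)=sf_1+bf_2,\qquad b=\tfrac{-3st}{3s^2-1}.$$ A solution ring for $M$ is a non-zero ID-ring $R$ with an ID-homomorphism $S\to R$ such that $R\otimes_{C_R}C_{R\otimes_SM}\to R\otimes_SM$ is an isomorphism, where $C_{(\cdot)}$ denotes constants. A Picard–Vessiot ring for $M$ is an ID-simple solution ring $R$ with the same constants as $S$ that is minimal: every injective ID-homomorphism over $S$ from a solution ring to $R$ is an isomorphism. The ID-Galois group scheme of $R/S$ is the group functor $D\mapsto \mathrm{Aut}^\theta(R\otimes_CD/S\otimes_CD)$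 on $C$-algebras, where $D$ has the trivial iterative derivation. The constants of $S$ are $C$. For $\varepsilon\in\{1,-1\}$ let $\mathfrak m_\varepsilon=(s-\varepsilon,t)\subset S$. The map $S\to (S/\mathfrak m_\varepsilon)[[t]]\cong C[[t]]$, $a\mapsto\sum_n\overline{\theta^{(n)}(a)}\,t^n$, is injective. In $C[[t]]$, regarded as an extension of $S$ by this map, $\varepsilon s$ has a square root $\sqrt{\varepsilon s}$ with constant term $1$, and the unique Picard–Vessiot ring for $M$ inside $C[[t]]$ (with the iterative derivation with respect to $t$) is $$R_\varepsilon=S\left[\sqrt{\varepsilon s},\frac{t}{\sqrt{\varepsilon s}}\right].$$ It is finite over $S$ of degree (rank) $2$, and its ID-Galois group scheme is isomorphic to $\mu_2$. If $-1$ is not a square in $C$, then the Picard–Vessiot rings $R_1=S[\sqrt s,t/\sqrt s]$ and $R_{-1}=S[\sqrt{-s},t/\sqrt{-s}]$ for $M$ are not isomorphic as $S$-algebras; so Picard–Vessiot rings for $M$ are then not unique. -/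

import Mathlib

open scoped TensorProduct
open Finset.HasAntidiagonal (antidiagonal)

universe u

set_option linter.unusedSectionVars false

noncomputable section

/-! ### Iterative differential rings and modules -/

/-- An iterative derivation `(θ n)ₙ` on a commutative ring `R`. -/
class IDRing (R : Type*) [CommRing R] where
  θ : ℕ → R →+ R
  θ_zero : ∀ x, θ 0 x = x
  θ_mul : ∀ n x y, θ n (x * y) = ∑ p ∈ antidiagonal n, θ p.1 x * θ p.2 y
  θ_comp : ∀ i j x, θ i (θ j x) = (i + j).choose i • θ (i + j) x

/-- An algebra of ID-rings: the structure map is a homomorphism of ID-rings. -/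
class IDAlgebra (S R : Type*) [CommRing S] [IDRing S] [CommRing R] [IDRing R]
    [Algebra S R] : Prop where
  θ_algebraMap : ∀ n (x : S), IDRing.θ n (algebraMap S R x) = algebraMap S R (IDRing.θ n x)

/-- The elements of `C` become constants in the ID-ring `R`, in other words `R` is an ID-algebra
over `C` with its trivial iterative derivation. -/
class IDConstAlgebra (C R : Type*) [CommRing C] [CommRing R] [IDRing R]
    [Algebra C R] : Prop where
  θ_algebraMap_eq_zero : ∀ n, 0 < n → ∀ c : C, IDRing.θ n (algebraMap C R c) = 0

/-- An ID-module over an ID-ring: a finitely generated module with an iterative derivation. -/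
class IDModule (R M : Type*) [CommRing R] [IDRing R] [AddCommGroup M] [Module R M] where
  finite : Module.Finite R M
  θ : ℕ → M →+ M
  θ_zero : ∀ m, θ 0 m = m
  θ_smul : ∀ n (r : R) (m : M), θ n (r • m) = ∑ p ∈ antidiagonal n, IDRing.θ p.1 r • θ p.2 m
  θ_comp : ∀ i j m, θ i (θ j m) = (i + j).choose i • θ (i + j) m

section Basic

variable (R : Type*) [CommRing R] [IDRing R]

lemma IDRing.θ_one {n : ℕ} (hn : 0 < n) : IDRing.θ n (1 : R) = 0 := by
  induction n using Nat.strong_induction_on with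
  | _ n ih =>
    have h := IDRing.θ_mul n (1 : R) 1
    rw [← Finset.sum_subset (s₁ := {(0, n), (n, 0)}), Finset.sum_pair] at h
    · simpa [IDRing.θ_zero] using h
    · intro h0
      simp at h0
      omega
    · intro p hp
      simp only [Finset.mem_insert, Finset.mem_singleton] at hp
      rcases hp with rfl | rfl <;> simp
    · intro p hp hne
      rw [Finset.HasAntidiagonal.mem_antidiagonal] at hp
      simp only [Finset.mem_insert, Finset.mem_singleton, Prod.ext_iff, not_or] at hne
      rw [ih p.1 (by omega) (by omega), zero_mul]

/-- The ring of constants `C_R`. -/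
def IDRing.constants : Subring R where
  carrier := {x | ∀ n, 0 < n → IDRing.θ n x = 0}
  mul_mem' {x y} hx hy n hn := by
    rw [IDRing.θ_mul]
    refine Finset.sum_eq_zero fun p hp => ?_
    rw [Finset.HasAntidiagonal.mem_antidiagonal] at hp
    rcases Nat.eq_zero_or_pos p.1 with h | h
    · rw [hy p.2 (by omega), mul_zero]
    · rw [hx p.1 h, zero_mul]
  one_mem' n hn := IDRing.θ_one R hn
  add_mem' {x y} hx hy n hn := by rw [map_add, hx n hn, hy n hn, add_zero]
  zero_mem' n _ := map_zero _
  neg_mem' {x} hx n hn := by rw [map_neg, hx n hn, neg_zero]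

/-- `R` is ID-simple: it is non-zero and has no ID-ideals besides `0` and `R`. -/
def IDSimple : Prop :=
  Nontrivial R ∧ ∀ I : Ideal R, (∀ n, ∀ x ∈ I, IDRing.θ n x ∈ I) → I = ⊥ ∨ I = ⊤

end Basic

/-! ### The tensor product `R ⊗ M`, solution rings and Picard-Vessiot rings -/

section PicardVessiot

variable (S M R : Type*) [CommRing S] [IDRing S] [AddCommGroup M] [Module S M] [IDModule S M]
  [CommRing R] [IDRing R] [Algebra S R] [IDAlgebra S R]

/-- A triple sum over `i + j + k = n` can be bracketed in two ways. -/
lemma sum_antidiagonal_assoc {P : Type*} [AddCommMonoid P] (f : ℕ → ℕ → ℕ → P) (n : ℕ) :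
    ∑ p ∈ antidiagonal n, ∑ q ∈ antidiagonal p.1, f q.1 q.2 p.2
      = ∑ p ∈ antidiagonal n, ∑ q ∈ antidiagonal p.2, f p.1 q.1 q.2 := by
  rw [Finset.sum_sigma', Finset.sum_sigma']
  refine Finset.sum_nbij' (fun x => ⟨(x.2.1, x.2.2 + x.1.2), (x.2.2, x.1.2)⟩)
    (fun x => ⟨(x.1.1 + x.2.1, x.2.2), (x.1.1, x.2.1)⟩) ?_ ?_ ?_ ?_ ?_ <;>
  · rintro ⟨⟨a, b⟩, ⟨c, d⟩⟩ h
    simp only [Finset.mem_sigma, Finset.HasAntidiagonal.mem_antidiagonal] at h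
    obtain ⟨rfl, rfl⟩ := h
    first | done | rfl | simp [add_assoc]

/-- The iterative derivation of `R ⊗ M`:
`θ n (r ⊗ m) = ∑ i + j = n, θ i r ⊗ θ j m`. -/
def tensorθ (n : ℕ) : R ⊗[S] M →+ R ⊗[S] M :=
  TensorProduct.liftAddHom
    (∑ p ∈ antidiagonal n,
      { toFun := fun r =>
          { toFun := fun m => IDRing.θ p.1 r ⊗ₜ[S] IDModule.θ S p.2 m
            map_zero' := by rw [map_zero, TensorProduct.tmul_zero]
            map_add' := fun x y => by rw [map_add, TensorProduct.tmul_add] }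
        map_zero' := by ext m; simp
        map_add' := fun x y => by ext m; simp [TensorProduct.add_tmul] })
    (fun s r m => by
      simp only [AddMonoidHom.finsetSum_apply, AddMonoidHom.coe_mk, ZeroHom.coe_mk,
        IDModule.θ_smul, Algebra.smul_def, IDRing.θ_mul, IDAlgebra.θ_algebraMap,
        TensorProduct.sum_tmul, TensorProduct.tmul_sum]
      simp only [← Algebra.smul_def, TensorProduct.smul_tmul', TensorProduct.tmul_smul]
      rw [← sum_antidiagonal_assoc (fun i j k =>
        (IDRing.θ j s • IDRing.θ i r) ⊗ₜ[S] IDModule.θ S k m)]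
      refine Finset.sum_congr rfl fun p _ => ?_
      exact (Finset.Nat.sum_antidiagonal_swap (f := fun q : ℕ × ℕ =>
        (IDRing.θ q.1 s • IDRing.θ q.2 r) ⊗ₜ[S] IDModule.θ S p.2 m)).symm)

lemma tensorθ_tmul (n : ℕ) (r : R) (m : M) :
    tensorθ S M R n (r ⊗ₜ m)
      = ∑ p ∈ antidiagonal n, IDRing.θ p.1 r ⊗ₜ[S] IDModule.θ S p.2 m := by
  simp [tensorθ, AddMonoidHom.finsetSum_apply]

lemma tensorθ_smul (n : ℕ) (r : R) (z : R ⊗[S] M) :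
    tensorθ S M R n (r • z) = ∑ p ∈ antidiagonal n, IDRing.θ p.1 r • tensorθ S M R p.2 z := by
  induction z using TensorProduct.induction_on with
  | zero => simp
  | add x y hx hy => simp [hx, hy, Finset.sum_add_distrib]
  | tmul a m =>
    simp only [TensorProduct.smul_tmul', smul_eq_mul, tensorθ_tmul, IDRing.θ_mul,
      TensorProduct.sum_tmul, Finset.smul_sum]
    exact sum_antidiagonal_assoc
      (fun i j k => (IDRing.θ i r * IDRing.θ j a) ⊗ₜ[S] IDModule.θ S k m) n

/-- The constants `C_{R ⊗ M}`, as a module over the ring of constants `C_R`. -/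
def tensorConstants : Submodule (IDRing.constants R) (R ⊗[S] M) where
  carrier := {z | ∀ n, 0 < n → tensorθ S M R n z = 0}
  add_mem' {x y} hx hy n hn := by rw [map_add, hx n hn, hy n hn, add_zero]
  zero_mem' n _ := map_zero _
  smul_mem' c z hz n hn := by
    change tensorθ S M R n ((c : R) • z) = 0
    rw [tensorθ_smul]
    refine Finset.sum_eq_zero fun p hp => ?_
    rw [Finset.HasAntidiagonal.mem_antidiagonal] at hp
    rcases Nat.eq_zero_or_pos p.1 with h | h
    · rw [hz p.2 (by omega), smul_zero]
    · rw [c.2 p.1 h, zero_smul]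

/-- `R` is a solution ring for the ID-module `M`: it is non-zero and the natural map
`R ⊗[C_R] C_{R ⊗ M} → R ⊗ M` is an isomorphism. -/
def IsSolutionRing : Prop :=
  Nontrivial R ∧ IsBaseChange R (tensorConstants S M R).subtype

end PicardVessiot

/-- `R` is a Picard-Vessiot ring for the ID-module `M` over `S`: a minimal solution ring that is
ID-simple and has the same constants as `S`.  Minimality: every injective homomorphism of
ID-rings over `S` from a solution ring to `R` is an isomorphism. -/
structure IsPicardVessiotRing (S : Type*) (M : Type*) (R : Type u) [CommRing S] [IDRing S]
    [AddCommGroup M] [Module S M] [IDModule S M]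
    [CommRing R] [IDRing R] [Algebra S R] [IDAlgebra S R] : Prop where
  isSolutionRing : IsSolutionRing S M R
  idSimple : IDSimple R
  constants_eq : IDRing.constants R = (IDRing.constants S).map (algebraMap S R)
  minimal : ∀ (R' : Type u) [CommRing R'] [IDRing R'] [Algebra S R'] [IDAlgebra S R'],
    IsSolutionRing S M R' → ∀ g : R' →ₐ[S] R, (∀ n x, g (IDRing.θ n x) = IDRing.θ n (g x)) →
      Function.Injective g → Function.Bijective g

/-! ### The ID-Galois group functor -/

section Galois

variable (C S R : Type*) [CommRing C] [CommRing S] [IDRing S] [CommRing R] [IDRing R]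
  [Algebra C S] [Algebra C R] [Algebra S R] [IsScalarTower C S R]
  [IDConstAlgebra C R] (D : Type*) [CommRing D] [Algebra C D]

/-- `θ n` on `R` as a `C`-linear map. -/
def IDRing.θLin (n : ℕ) : R →ₗ[C] R where
  toFun := IDRing.θ n
  map_add' := map_add _
  map_smul' c x := by
    rw [Algebra.smul_def, IDRing.θ_mul, Finset.sum_eq_single (0, n)]
    · rw [IDRing.θ_zero, RingHom.id_apply, Algebra.smul_def]
    · rintro ⟨i, j⟩ h hne
      rw [Finset.HasAntidiagonal.mem_antidiagonal] at h
      rw [IDConstAlgebra.θ_algebraMap_eq_zero i (Nat.pos_of_ne_zero ?_), zero_mul]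
      rintro rfl
      exact hne (by simpa using h)
    · intro h
      simp at h

/-- The iterative derivation of `R ⊗[C] D`, where `D` carries the trivial one:
`θ n (r ⊗ d) = θ n r ⊗ d`. -/
def baseθ (n : ℕ) : R ⊗[C] D →ₗ[C] R ⊗[C] D :=
  (IDRing.θLin C R n).rTensor D

/-- The group `Aut^θ(R ⊗ D / S ⊗ D)` of ID-automorphisms of `R ⊗[C] D` that fix the elements of
`S ⊗[C] D`. (The image of `C` lies in `S ⊗[C] D`, so such automorphisms are `C`-linear.) -/
def idGal : Subgroup ((R ⊗[C] D) ≃ₐ[C] (R ⊗[C] D)) where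
  carrier := {σ | (∀ n z, σ (baseθ C R D n z) = baseθ C R D n (σ z)) ∧
    ∀ z : S ⊗[C] D, σ (Algebra.TensorProduct.map (IsScalarTower.toAlgHom C S R) (AlgHom.id C D) z)
      = Algebra.TensorProduct.map (IsScalarTower.toAlgHom C S R) (AlgHom.id C D) z}
  mul_mem' {σ τ} hσ hτ := ⟨fun n z => by simp only [AlgEquiv.mul_apply, hτ.1, hσ.1],
    fun z => by simp only [AlgEquiv.mul_apply, hτ.2, hσ.2]⟩
  one_mem' := ⟨fun _ _ => rfl, fun _ => rfl⟩
  inv_mem' {σ} hσ := ⟨fun n z => by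
      change σ.symm _ = baseθ C R D n (σ.symm z)
      rw [AlgEquiv.symm_apply_eq, hσ.1, AlgEquiv.apply_symm_apply],
    fun z => by
      change σ.symm _ = _
      rw [AlgEquiv.symm_apply_eq, hσ.2]⟩

variable {C S R D} {D' : Type*} [CommRing D'] [Algebra C D']

/-- The `D'`-linear extension of an automorphism of `R ⊗[C] D` along `φ : D → D'`:
`r ⊗ d' ↦ (id ⊗ φ) (σ (r ⊗ 1)) * (1 ⊗ d')`. -/
def extendScalars (φ : D →ₐ[C] D') (σ : (R ⊗[C] D) ≃ₐ[C] (R ⊗[C] D)) :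
    R ⊗[C] D' →ₐ[C] R ⊗[C] D' :=
  Algebra.TensorProduct.lift
    ((Algebra.TensorProduct.map (AlgHom.id C R) φ).comp
      ((σ : R ⊗[C] D →ₐ[C] R ⊗[C] D).comp Algebra.TensorProduct.includeLeft))
    Algebra.TensorProduct.includeRight (fun _ _ => mul_comm _ _)

lemma extendScalars_tmul (φ : D →ₐ[C] D') (σ : (R ⊗[C] D) ≃ₐ[C] (R ⊗[C] D)) (r : R) (d' : D') :
    extendScalars φ σ (r ⊗ₜ d')
      = Algebra.TensorProduct.map (AlgHom.id C R) φ (σ (r ⊗ₜ 1)) * (1 ⊗ₜ d') := by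
  rfl

lemma idGal_fix {σ : (R ⊗[C] D) ≃ₐ[C] (R ⊗[C] D)} (hσ : σ ∈ idGal C S R D) (d : D) :
    σ (1 ⊗ₜ d) = 1 ⊗ₜ d := by
  simpa using hσ.2 (1 ⊗ₜ d)

lemma extendScalars_map (φ : D →ₐ[C] D') {σ : (R ⊗[C] D) ≃ₐ[C] (R ⊗[C] D)}
    (hσ : σ ∈ idGal C S R D) (z : R ⊗[C] D) :
    extendScalars φ σ (Algebra.TensorProduct.map (AlgHom.id C R) φ z)
      = Algebra.TensorProduct.map (AlgHom.id C R) φ (σ z) := by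
  induction z using TensorProduct.induction_on with
  | zero => simp
  | add x y hx hy => simp only [map_add, hx, hy]
  | tmul r d =>
    have h : (r ⊗ₜ[C] d : R ⊗[C] D) = (r ⊗ₜ 1) * (1 ⊗ₜ d) := by simp
    conv_rhs => rw [h, map_mul, idGal_fix hσ, map_mul]
    simp [extendScalars_tmul]

lemma extendScalars_comp (φ : D →ₐ[C] D') {σ τ : (R ⊗[C] D) ≃ₐ[C] (R ⊗[C] D)}
    (hσ : σ ∈ idGal C S R D) (z : R ⊗[C] D') :
    extendScalars φ σ (extendScalars φ τ z) = extendScalars φ (σ * τ) z := by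
  induction z using TensorProduct.induction_on with
  | zero => simp
  | add x y hx hy => simp only [map_add, hx, hy]
  | tmul r d =>
    rw [extendScalars_tmul, extendScalars_tmul, map_mul, extendScalars_map φ hσ,
      extendScalars_tmul]
    congr 1
    rw [show (1 ⊗ₜ[C] (1 : D) : R ⊗[C] D) = 1 from rfl, map_one, map_one, one_mul]

lemma extendScalars_one (φ : D →ₐ[C] D') (z : R ⊗[C] D') :
    extendScalars φ (1 : (R ⊗[C] D) ≃ₐ[C] (R ⊗[C] D)) z = z := by
  induction z using TensorProduct.induction_on with
  | zero => simp
  | add x y hx hy => simp only [map_add, hx, hy]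
  | tmul r d => simp [extendScalars_tmul]

lemma baseθ_map_mul (φ : D →ₐ[C] D') (n : ℕ) (z : R ⊗[C] D) (d' : D') :
    baseθ C R D' n (Algebra.TensorProduct.map (AlgHom.id C R) φ z * (1 ⊗ₜ d'))
      = Algebra.TensorProduct.map (AlgHom.id C R) φ (baseθ C R D n z) * (1 ⊗ₜ d') := by
  induction z using TensorProduct.induction_on with
  | zero => simp
  | add x y hx hy => simp only [map_add, add_mul, hx, hy]
  | tmul r d => simp [baseθ]

lemma extendScalars_baseθ (φ : D →ₐ[C] D') {σ : (R ⊗[C] D) ≃ₐ[C] (R ⊗[C] D)}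
    (hσ : σ ∈ idGal C S R D) (n : ℕ) (z : R ⊗[C] D') :
    extendScalars φ σ (baseθ C R D' n z) = baseθ C R D' n (extendScalars φ σ z) := by
  induction z using TensorProduct.induction_on with
  | zero => simp
  | add x y hx hy => simp only [map_add, hx, hy]
  | tmul r d =>
    rw [extendScalars_tmul, baseθ_map_mul, ← hσ.1]
    simp [baseθ, extendScalars_tmul]

lemma extendScalars_fix (φ : D →ₐ[C] D') {σ : (R ⊗[C] D) ≃ₐ[C] (R ⊗[C] D)}
    (hσ : σ ∈ idGal C S R D) (z : S ⊗[C] D') :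
    extendScalars φ σ
        (Algebra.TensorProduct.map (IsScalarTower.toAlgHom C S R) (AlgHom.id C D') z)
      = Algebra.TensorProduct.map (IsScalarTower.toAlgHom C S R) (AlgHom.id C D') z := by
  induction z using TensorProduct.induction_on with
  | zero => simp
  | add x y hx hy => simp only [map_add, hx, hy]
  | tmul s d =>
    have h := hσ.2 (s ⊗ₜ 1)
    simp only [Algebra.TensorProduct.map_tmul, map_one] at h
    rw [Algebra.TensorProduct.map_tmul, extendScalars_tmul, h]
    simp

/-- The group functor `Gal(R/S) : Algebras/C → Groups`, on morphisms. -/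
def idGalMap (φ : D →ₐ[C] D') : idGal C S R D →* idGal C S R D' where
  toFun σ := ⟨AlgEquiv.ofAlgHom (extendScalars φ σ.1) (extendScalars φ σ⁻¹.1)
      (AlgHom.ext fun z => by
        rw [AlgHom.comp_apply, extendScalars_comp φ σ.2, ← Subgroup.coe_mul, mul_inv_cancel]
        exact extendScalars_one φ z)
      (AlgHom.ext fun z => by
        rw [AlgHom.comp_apply, extendScalars_comp φ σ⁻¹.2, ← Subgroup.coe_mul, inv_mul_cancel]
        exact extendScalars_one φ z),
    fun n z => extendScalars_baseθ φ σ.2 n z, fun z => extendScalars_fix φ σ.2 z⟩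
  map_one' := Subtype.ext (AlgEquiv.ext fun z => extendScalars_one φ z)
  map_mul' σ τ := Subtype.ext (AlgEquiv.ext fun z => (extendScalars_comp φ σ.2 z).symm)

end Galois

/-- The ID-Galois group functor of `R/S` is isomorphic to the group scheme `μ_m` of `m`-th roots of
unity over `C`: there are group isomorphisms `Gal(R/S)(D) ≅ μ_m(D)`, natural in `D`. -/
def GalIsoMu (C : Type u) (S R : Type*) [CommRing C] [CommRing S] [IDRing S] [CommRing R]
    [IDRing R] [Algebra C S] [Algebra C R] [Algebra S R] [IsScalarTower C S R]
    [IDConstAlgebra C R] (m : ℕ) : Prop :=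
  ∃ e : ∀ (D : Type u) [CommRing D] [Algebra C D], idGal C S R D ≃* rootsOfUnity m D,
    ∀ (D D' : Type u) [CommRing D] [Algebra C D] [CommRing D'] [Algebra C D'] (φ : D →ₐ[C] D')
      (σ : idGal C S R D), e D' (idGalMap φ σ) = restrictRootsOfUnity φ m (e D σ)

/-! ### Sub-ID-algebras -/

/-- An `S`-subalgebra that is stable under the iterative derivation. -/
structure IDSubalgebra (S A : Type*) [CommRing S] [CommRing A] [IDRing A] [Algebra S A] extends
    Subalgebra S A where
  θ_mem : ∀ n, ∀ x ∈ toSubalgebra, IDRing.θ n x ∈ toSubalgebra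

section IDSubalgebra

variable {C S A : Type*} [CommRing C] [CommRing S] [CommRing A] [IDRing A] [Algebra S A]
  (R : IDSubalgebra S A)

instance : IDRing R.toSubalgebra where
  θ n := { toFun := fun x => ⟨IDRing.θ n (x : A), R.θ_mem n x x.2⟩
           map_zero' := Subtype.ext (map_zero _)
           map_add' := fun x y => Subtype.ext (map_add _ _ _) }
  θ_zero x := Subtype.ext (IDRing.θ_zero _)
  θ_mul n x y := Subtype.ext (by
    simp only [AddMonoidHom.coe_mk, ZeroHom.coe_mk, AddSubmonoidClass.coe_finsetSum,
      MulMemClass.coe_mul]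
    exact IDRing.θ_mul n (x : A) y)
  θ_comp i j x := Subtype.ext (IDRing.θ_comp i j (x : A))

instance [IDRing S] [IDAlgebra S A] : IDAlgebra S R.toSubalgebra where
  θ_algebraMap n x := Subtype.ext (IDAlgebra.θ_algebraMap n x)

instance [Algebra C S] [Algebra C A] [IsScalarTower C S A] [IDConstAlgebra C A] :
    IDConstAlgebra C R.toSubalgebra where
  θ_algebraMap_eq_zero n hn c :=
    Subtype.ext (IDConstAlgebra.θ_algebraMap_eq_zero (R := A) n hn c)

end IDSubalgebra

/-! ### Iterative derivations from derivations in characteristic zero -/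

section OfDerivation

variable {C A : Type*} [Field C] [CharZero C] [CommRing A] [Algebra C A]

/-- The divided power `∂ⁿ / n!`. -/
def dividedPow {M : Type*} [AddCommGroup M] [Module C M] (δ : M →ₗ[C] M) (n : ℕ) : M →ₗ[C] M :=
  (n.factorial : C)⁻¹ • δ ^ n

lemma dividedPow_comp {M : Type*} [AddCommGroup M] [Module C M] (δ : M →ₗ[C] M) (i j : ℕ) (m : M) :
    dividedPow δ i (dividedPow δ j m) = (i + j).choose i • dividedPow δ (i + j) m := by
  simp only [dividedPow, LinearMap.smul_apply, map_smul, ← Module.End.mul_apply, ← pow_add]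
  rw [← Nat.cast_smul_eq_nsmul C, smul_smul, smul_smul, Nat.cast_add_choose]
  congr 1
  have h1 : (i.factorial : C) ≠ 0 := Nat.cast_ne_zero.2 i.factorial_ne_zero
  have h2 : (j.factorial : C) ≠ 0 := Nat.cast_ne_zero.2 j.factorial_ne_zero
  have h3 : ((i + j).factorial : C) ≠ 0 := Nat.cast_ne_zero.2 (i + j).factorial_ne_zero
  field_simp

lemma pow_leibniz {M : Type*} [AddCommGroup M] [Module C M] [Module A M] (D : A →ₗ[C] A)
    (δ : M →ₗ[C] M) (h : ∀ (a : A) (m : M), δ (a • m) = D a • m + a • δ m)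
    (n : ℕ) (a : A) (m : M) :
    (δ ^ n) (a • m)
      = ∑ p ∈ antidiagonal n, n.choose p.1 • ((D ^ p.1) a • (δ ^ p.2) m) := by
  induction n with
  | zero => simp
  | succ n ih =>
    rw [pow_succ', Module.End.mul_apply, ih, map_sum,
      Finset.sum_antidiagonal_choose_succ_nsmul (fun i j => (D ^ i) a • (δ ^ j) m),
      ← Finset.sum_add_distrib]
    refine Finset.sum_congr rfl fun p hp => ?_
    have hc : n.choose p.2 = n.choose p.1 := by
      rw [Finset.HasAntidiagonal.mem_antidiagonal] at hp
      exact (Nat.choose_symm_of_eq_add (by omega))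
    rw [map_nsmul, h, nsmul_add, hc, add_comm, pow_succ' D, pow_succ' δ, Module.End.mul_apply,
      Module.End.mul_apply]

lemma dividedPow_leibniz {M : Type*} [AddCommGroup M] [Module C M] [Module A M]
    [IsScalarTower C A M] (D : A →ₗ[C] A) (δ : M →ₗ[C] M)
    (h : ∀ (a : A) (m : M), δ (a • m) = D a • m + a • δ m) (n : ℕ) (a : A) (m : M) :
    dividedPow δ n (a • m)
      = ∑ p ∈ antidiagonal n, dividedPow D p.1 a • dividedPow δ p.2 m := by
  simp only [dividedPow, LinearMap.smul_apply]
  rw [pow_leibniz D δ h, Finset.smul_sum]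
  refine Finset.sum_congr rfl fun p hp => ?_
  rw [Finset.HasAntidiagonal.mem_antidiagonal] at hp
  subst hp
  have h3 : ((p.1 + p.2).factorial : C) ≠ 0 := Nat.cast_ne_zero.2 (Nat.factorial_ne_zero _)
  rw [← Nat.cast_smul_eq_nsmul C, smul_smul, smul_assoc, ← algebraMap_smul A
    ((p.2.factorial : C)⁻¹), smul_comm _ (algebraMap C A _), algebraMap_smul, smul_smul,
    Nat.cast_add_choose]
  congr 1
  field_simp

/-- A derivation `D` in characteristic zero gives the iterative derivation `θ n = Dⁿ / n!`. -/
abbrev IDRing.ofDerivation (D : Derivation C A A) : IDRing A where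
  θ n := (dividedPow D.toLinearMap n).toAddMonoidHom
  θ_zero x := by simp [dividedPow]
  θ_mul n x y := dividedPow_leibniz D.toLinearMap D.toLinearMap
    (fun a m => by simp [mul_comm, add_comm]) n x y
  θ_comp i j x := dividedPow_comp _ i j x

lemma dividedPow_algebraMap (D : Derivation C A A) (n : ℕ) (hn : 0 < n) (c : C) :
    dividedPow D.toLinearMap n (algebraMap C A c) = 0 := by
  obtain ⟨k, rfl⟩ : ∃ k, n = k + 1 := ⟨n - 1, by omega⟩
  simp [dividedPow, pow_succ]

end OfDerivation

/-! ### The ring `S = C[s, t, 1/(3s² - 1)] / (s³ - s - t²)` -/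

section CurveRing

open MvPolynomial

variable (C : Type u) [Field C]

/-- The relations `s³ - s - t² = 0` and `w (3s² - 1) = 1`, with `s`, `t`, `w` the three variables. -/
def curveIdeal : Ideal (MvPolynomial (Fin 3) C) :=
  Ideal.span {X 0 ^ 3 - X 0 - X 1 ^ 2, X 2 * (3 * X 0 ^ 2 - 1) - 1}

/-- The ring `S = C[s, t, 1/(3s² - 1)] / (s³ - s - t²)`. -/
def CurveRing : Type u := MvPolynomial (Fin 3) C ⧸ curveIdeal C

namespace CurveRing

instance : CommRing (CurveRing C) :=
  inferInstanceAs (CommRing (MvPolynomial (Fin 3) C ⧸ curveIdeal C))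

instance : Algebra C (CurveRing C) :=
  inferInstanceAs (Algebra C (MvPolynomial (Fin 3) C ⧸ curveIdeal C))

/-- The quotient map from the polynomial ring. -/
def mk : MvPolynomial (Fin 3) C →ₐ[C] CurveRing C := Ideal.Quotient.mkₐ C (curveIdeal C)

lemma mk_surjective : Function.Surjective (mk C) := Ideal.Quotient.mkₐ_surjective C (curveIdeal C)

lemma mk_eq_zero {x : MvPolynomial (Fin 3) C} : mk C x = 0 ↔ x ∈ curveIdeal C :=
  Ideal.Quotient.eq_zero_iff_mem

def s : CurveRing C := mk C (X 0)

def t : CurveRing C := mk C (X 1)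

/-- The inverse of `3s² - 1`. -/
def w : CurveRing C := mk C (X 2)

lemma s_t_relation : s C ^ 3 - s C - t C ^ 2 = 0 := by
  have := (mk_eq_zero C).2 (Ideal.subset_span (by simp) :
    X 0 ^ 3 - X 0 - X 1 ^ 2 ∈ curveIdeal C)
  simp only [map_sub, map_pow] at this
  exact this

lemma w_relation : w C * (3 * s C ^ 2 - 1) = 1 := by
  have := (mk_eq_zero C).2 (Ideal.subset_span (by simp) :
    X 2 * (3 * X 0 ^ 2 - 1) - 1 ∈ curveIdeal C)
  simp only [map_sub, map_pow, map_mul, map_one, map_ofNat, sub_eq_zero] at this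
  exact this

/-- The lift of the derivation of `S` to the polynomial ring. -/
def polyDeriv : Derivation C (MvPolynomial (Fin 3) C) (MvPolynomial (Fin 3) C) :=
  mkDerivation C ![2 * X 1 * X 2, 1, - X 2 ^ 2 * (6 * X 0 * (2 * X 1 * X 2))]

lemma polyDeriv_mem (x : MvPolynomial (Fin 3) C) (hx : x ∈ curveIdeal C) :
    polyDeriv C x ∈ curveIdeal C := by
  have h2 : X 2 * (3 * X 0 ^ 2 - 1) - 1 ∈ curveIdeal C := Ideal.subset_span (by simp)
  induction hx using Submodule.span_induction with
  | zero => simp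
  | add x y _ _ hx hy => rw [map_add]; exact add_mem hx hy
  | smul a x hx h =>
    rw [smul_eq_mul, Derivation.leibniz]
    exact add_mem (Ideal.mul_mem_left _ _ h) (Ideal.mul_mem_right _ _ hx)
  | mem x hx =>
    have e0 : polyDeriv C (X 0) = 2 * X 1 * X 2 := by simp [polyDeriv, mkDerivation_X]
    have e1 : polyDeriv C (X 1) = 1 := by simp [polyDeriv, mkDerivation_X]
    have e2 : polyDeriv C (X 2) = - X 2 ^ 2 * (6 * X 0 * (2 * X 1 * X 2)) := by
      simp [polyDeriv, mkDerivation_X]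
    have e3 : polyDeriv C 3 = 0 := (polyDeriv C).map_natCast 3
    rcases hx with rfl | rfl
    · have : polyDeriv C (X 0 ^ 3 - X 0 - X 1 ^ 2)
          = 2 * X 1 * (X 2 * (3 * X 0 ^ 2 - 1) - 1) := by
        simp only [map_sub, Derivation.leibniz_pow, e0, e1, smul_eq_mul, nsmul_eq_mul]
        push_cast
        ring
      rw [this]
      exact Ideal.mul_mem_left _ _ h2
    · have : polyDeriv C (X 2 * (3 * X 0 ^ 2 - 1) - 1)
          = (-12 * X 0 * X 1 * X 2 ^ 2) * (X 2 * (3 * X 0 ^ 2 - 1) - 1) := by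
        simp only [map_sub, Derivation.leibniz, Derivation.leibniz_pow, e0, e2, e3, smul_eq_mul,
          nsmul_eq_mul, Derivation.map_one_eq_zero]
        push_cast
        ring
      rw [this]
      exact Ideal.mul_mem_left _ _ h2

/-- The derivation `∂` of `S` that extends `d/dt` on `C[t]`. -/
def deriv : Derivation C (CurveRing C) (CurveRing C) :=
  Derivation.liftOfSurjective (f := mk C) (mk_surjective C) (d := polyDeriv C)
    (fun x hx => (mk_eq_zero C).2 (polyDeriv_mem C x ((mk_eq_zero C).1 hx)))

lemma deriv_mk (x : MvPolynomial (Fin 3) C) : deriv C (mk C x) = mk C (polyDeriv C x) :=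
  Derivation.liftOfSurjective_apply (f := mk C) (mk_surjective C) (d := polyDeriv C)
    (fun x hx => (mk_eq_zero C).2 (polyDeriv_mem C x ((mk_eq_zero C).1 hx))) x

lemma deriv_t : deriv C (t C) = 1 := by
  rw [t, deriv_mk]; simp [polyDeriv, mkDerivation_X]

lemma deriv_s : deriv C (s C) = 2 * t C * w C := by
  rw [s, deriv_mk]; simp [polyDeriv, mkDerivation_X, t, w, map_ofNat (mk C) 2]

variable [CharZero C]

/-- `S` with the iterative derivation extending the one by `t` on `C[t]`. -/
instance : IDRing (CurveRing C) := IDRing.ofDerivation (deriv C)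

instance : IDConstAlgebra C (CurveRing C) where
  θ_algebraMap_eq_zero n hn c := dividedPow_algebraMap (deriv C) n hn c

end CurveRing

/-! ### The non-free module `M = ⟨f₁, f₂ | t f₁ = s f₂, (s² - 1) f₁ = t f₂⟩` -/

open CurveRing

/-- The relations `t f₁ - s f₂ = 0` and `(s² - 1) f₁ - t f₂ = 0`. -/
def moduleRelations : Submodule (CurveRing C) (CurveRing C × CurveRing C) :=
  Submodule.span _ {(t C, - s C), (s C ^ 2 - 1, - t C)}

variable {C} in
/-- The `S`-module `M` generated by `f₁`, `f₂` with the relations above. The parameter `b` only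
selects the derivation put on it below. -/
def NonFreeModule (_b : CurveRing C) : Type u :=
  (CurveRing C × CurveRing C) ⧸ moduleRelations C

namespace NonFreeModule

variable {C} (b : CurveRing C)

instance : AddCommGroup (NonFreeModule b) :=
  inferInstanceAs (AddCommGroup ((CurveRing C × CurveRing C) ⧸ moduleRelations C))

instance : Module (CurveRing C) (NonFreeModule b) :=
  inferInstanceAs (Module (CurveRing C) ((CurveRing C × CurveRing C) ⧸ moduleRelations C))

instance : Module C (NonFreeModule b) :=
  inferInstanceAs (Module C ((CurveRing C × CurveRing C) ⧸ moduleRelations C))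

instance : IsScalarTower C (CurveRing C) (NonFreeModule b) :=
  inferInstanceAs (IsScalarTower C (CurveRing C) ((CurveRing C × CurveRing C) ⧸ moduleRelations C))

instance : Module.Finite (CurveRing C) (NonFreeModule b) :=
  inferInstanceAs (Module.Finite (CurveRing C) ((CurveRing C × CurveRing C) ⧸ moduleRelations C))

/-- The quotient map `S f₁ ⊕ S f₂ → M`. -/
def mk : (CurveRing C × CurveRing C) →ₗ[CurveRing C] NonFreeModule b := (moduleRelations C).mkQ

def f₁ : NonFreeModule b := mk b (1, 0)

def f₂ : NonFreeModule b := mk b (0, 1)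

lemma mk_surjective : Function.Surjective (mk b) := (moduleRelations C).mkQ_surjective

/-- The lift of `∂_M` to `S f₁ ⊕ S f₂`. -/
def preDeriv : (CurveRing C × CurveRing C) →ₗ[C] (CurveRing C × CurveRing C) where
  toFun x := (deriv C x.1 + x.1 * b + x.2 * s C,
    deriv C x.2 + x.1 * ((3 * s C ^ 2 + 1) * w C) + x.2 * b)
  map_add' x y := by ext <;> simp <;> ring
  map_smul' c x := by ext <;> simp [smul_add]

lemma preDeriv_smul (a : CurveRing C) (x : CurveRing C × CurveRing C) :
    preDeriv b (a • x) = deriv C a • x + a • preDeriv b x := by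
  ext <;> simp [preDeriv] <;> ring

lemma preDeriv_mem (x : CurveRing C × CurveRing C) (hx : x ∈ moduleRelations C) :
    preDeriv b x ∈ moduleRelations C := by
  have h1 : ((t C, - s C) : CurveRing C × CurveRing C) ∈ moduleRelations C :=
    Submodule.subset_span (by simp)
  have h2 : ((s C ^ 2 - 1, - t C) : CurveRing C × CurveRing C) ∈ moduleRelations C :=
    Submodule.subset_span (by simp)
  have hw := w_relation C
  have hst := s_t_relation C
  induction hx using Submodule.span_induction with
  | zero => rw [map_zero]; exact zero_mem _
  | add x y _ _ hx hy => rw [map_add]; exact add_mem hx hy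
  | smul a x hx h =>
    rw [preDeriv_smul]
    exact add_mem (Submodule.smul_mem _ _ hx) (Submodule.smul_mem _ _ h)
  | mem x hx =>
    rcases hx with rfl | rfl
    · have : preDeriv b (t C, - s C) = b • (t C, - s C) + (-1 : CurveRing C) • (s C ^ 2 - 1, - t C) := by
        ext
        · simp [preDeriv, deriv_t]; ring
        · simp [preDeriv, deriv_s]; linear_combination t C * hw
      rw [this]
      exact add_mem (Submodule.smul_mem _ _ h1) (Submodule.smul_mem _ _ h2)
    · have : preDeriv b (s C ^ 2 - 1, - t C)
          = b • (s C ^ 2 - 1, - t C) + (s C * (4 * w C - 1)) • (t C, - s C) := by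
        ext
        · simp [preDeriv, deriv_t, deriv_s]; ring
        · simp [preDeriv, deriv_t]; linear_combination (s C ^ 2 - 1 + 2) * hw
      rw [this]
      exact add_mem (Submodule.smul_mem _ _ h2) (Submodule.smul_mem _ _ h1)

/-- The derivation `∂_M` of `M` with `∂_M f₁ = b f₁ + (3s² + 1)/(3s² - 1) f₂` and
`∂_M f₂ = s f₁ + b f₂`. -/
def derivM : NonFreeModule b →ₗ[C] NonFreeModule b :=
  Submodule.mapQ ((moduleRelations C).restrictScalars C) ((moduleRelations C).restrictScalars C)
    (preDeriv b) (fun x hx => preDeriv_mem b x hx)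

lemma derivM_mk (x : CurveRing C × CurveRing C) : derivM b (mk b x) = mk b (preDeriv b x) := rfl

lemma derivM_smul (a : CurveRing C) (m : NonFreeModule b) :
    derivM b (a • m) = deriv C a • m + a • derivM b m := by
  obtain ⟨x, rfl⟩ := mk_surjective b m
  rw [← map_smul, derivM_mk, derivM_mk, preDeriv_smul, map_add, map_smul, map_smul]

lemma derivM_f₁ : derivM b (f₁ b) = b • f₁ b + ((3 * s C ^ 2 + 1) * w C) • f₂ b := by
  rw [f₁, f₂, derivM_mk, ← map_smul, ← map_smul, ← map_add]
  congr 1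
  ext <;> simp [preDeriv]

lemma derivM_f₂ : derivM b (f₂ b) = s C • f₁ b + b • f₂ b := by
  rw [f₁, f₂, derivM_mk, ← map_smul, ← map_smul, ← map_add]
  congr 1
  ext <;> simp [preDeriv]

variable [CharZero C]

/-- `M` as an ID-module over `S`, with `θ_M n = ∂_Mⁿ / n!`. -/
instance : IDModule (CurveRing C) (NonFreeModule b) where
  finite := inferInstance
  θ n := (dividedPow (derivM b) n).toAddMonoidHom
  θ_zero m := by simp [dividedPow]
  θ_smul n a m := dividedPow_leibniz (deriv C).toLinearMap (derivM b) (derivM_smul b) n a m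
  θ_comp i j m := dividedPow_comp _ i j m

end NonFreeModule

/-! ### The embeddings `S → C[[t]]` at the points `(1, 0)` and `(-1, 0)` -/

variable [CharZero C]

/-- `C[[t]]` with the iterative derivation with respect to `t`. -/
instance : IDRing (PowerSeries C) := IDRing.ofDerivation (PowerSeries.derivative C)

instance : IDConstAlgebra C (PowerSeries C) where
  θ_algebraMap_eq_zero n hn c := dividedPow_algebraMap (PowerSeries.derivative C) n hn c

/-- The iterative derivation of `C[[t]]` is given by `f(t) ↦ f(t + T)`. -/
lemma PowerSeries.coeff_θ (n k : ℕ) (f : PowerSeries C) :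
    PowerSeries.coeff k (IDRing.θ n f) = (k + n).choose n * PowerSeries.coeff (k + n) f := by
  have h : IDRing.θ n f = (n.factorial : C)⁻¹ • (PowerSeries.derivative C)^[n] f := by
    change dividedPow (PowerSeries.derivative C).toLinearMap n f = _
    rw [dividedPow, LinearMap.smul_apply, Module.End.pow_apply]
    rfl
  rw [h, map_smul, PowerSeries.coeff_iterate_derivative, smul_eq_mul, ← mul_assoc]
  congr 1
  have h1 : (n.factorial : C) ≠ 0 := Nat.cast_ne_zero.2 n.factorial_ne_zero
  rw [inv_mul_eq_iff_eq_mul₀ h1, ← Nat.cast_mul, Nat.ascFactorial_eq_factorial_mul_choose]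

variable {C} in
/-- The homomorphism `A → C[[t]]`, `a ↦ ∑ π(θ n a) tⁿ` attached to an ID-ring `A` over `C` and a
homomorphism `π : A → C` (so to a maximal ideal with residue field `C`). -/
def taylorHom {A : Type*} [CommRing A] [IDRing A] [Algebra C A] [IDConstAlgebra C A]
    (π : A →ₐ[C] C) : A →ₐ[C] PowerSeries C where
  toFun a := PowerSeries.mk fun n => π (IDRing.θ n a)
  map_one' := by
    ext n
    rcases Nat.eq_zero_or_pos n with rfl | h
    · simp [IDRing.θ_zero]
    · simp [IDRing.θ_one A h, PowerSeries.coeff_one, h.ne']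
  map_mul' x y := by
    ext n
    simp [IDRing.θ_mul, PowerSeries.coeff_mul]
  map_zero' := by ext n; simp
  map_add' x y := by ext n; simp
  commutes' c := by
    ext n
    rcases Nat.eq_zero_or_pos n with rfl | h
    · simp [IDRing.θ_zero]
    · simp [IDConstAlgebra.θ_algebraMap_eq_zero n h c, PowerSeries.coeff_C, h.ne']

variable {C} in
lemma taylorHom_θ {A : Type*} [CommRing A] [IDRing A] [Algebra C A] [IDConstAlgebra C A]
    (π : A →ₐ[C] C) (n : ℕ) (a : A) : IDRing.θ n (taylorHom π a) = taylorHom π (IDRing.θ n a) := by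
  ext k
  rw [PowerSeries.coeff_θ]
  simp only [taylorHom, AlgHom.coe_mk, RingHom.coe_mk, MonoidHom.coe_mk, OneHom.coe_mk,
    PowerSeries.coeff_mk, IDRing.θ_comp, Nat.choose_symm_add]
  rw [map_nsmul, nsmul_eq_mul]

/-- The `C`-rational point `(s, t) = (ε, 0)` of `S`, for `ε = ±1`. -/
def evalPoint (ε : ℤˣ) : CurveRing C →ₐ[C] C :=
  Ideal.Quotient.liftₐ (curveIdeal C) (aeval ![((ε : ℤ) : C), 0, 1 / 2]) (by
    have h : (((ε : ℤ) : C)) ^ 2 = 1 := by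
      rcases Int.units_eq_one_or ε with rfl | rfl <;> simp
    have h2 : (2 : C) ≠ 0 := two_ne_zero
    intro x hx
    rw [← RingHom.mem_ker]
    refine (Ideal.span_le (I := RingHom.ker (aeval ![((ε : ℤ) : C), 0, 1 / 2]))).2 ?_ hx
    rintro _ (rfl | rfl)
    · simp only [SetLike.mem_coe, RingHom.mem_ker, map_sub, map_pow, aeval_X]
      simp
      linear_combination ((ε : ℤ) : C) * h
    · simp only [SetLike.mem_coe, RingHom.mem_ker, map_sub, map_mul, map_pow, aeval_X, map_one,
        map_ofNat]
      simp [h]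
      norm_num)

lemma evalPoint_mk (ε : ℤˣ) (x : MvPolynomial (Fin 3) C) :
    evalPoint C ε (mk C x) = aeval ![((ε : ℤ) : C), 0, 1 / 2] x := rfl

lemma evalPoint_s (ε : ℤˣ) : evalPoint C ε (s C) = ((ε : ℤ) : C) := by
  simp [evalPoint_mk, s]

lemma evalPoint_t (ε : ℤˣ) : evalPoint C ε (t C) = 0 := by
  simp [evalPoint_mk, t]

/-- The point `(ε, 0)` corresponds to the ideal `(s - ε, t)`; so this ideal is maximal with residue
field `C`. -/
lemma ker_evalPoint (ε : ℤˣ) :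
    RingHom.ker (evalPoint C ε) = Ideal.span {s C - algebraMap C _ ((ε : ℤ) : C), t C} := by
  set J : Ideal (CurveRing C) := Ideal.span {s C - algebraMap C _ ((ε : ℤ) : C), t C} with hJ
  apply le_antisymm
  · have hs : s C - algebraMap C _ ((ε : ℤ) : C) ∈ J := Ideal.subset_span (by simp)
    have ht : t C ∈ J := Ideal.subset_span (by simp)
    have hε : (((ε : ℤ) : C)) ^ 2 = 1 := by
      rcases Int.units_eq_one_or ε with rfl | rfl <;> simp
    have hw : w C - algebraMap C _ (1 / 2) ∈ J := by
      have h1 : algebraMap C (CurveRing C) (1 / 2) * 2 = 1 := by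
        rw [← map_ofNat (algebraMap C (CurveRing C)) 2, ← map_mul]; norm_num
      have h2 : algebraMap C (CurveRing C) ((ε : ℤ) : C) ^ 2 = 1 := by
        rw [← map_pow, hε, map_one]
      have : w C - algebraMap C _ (1 / 2) = (- 3 * algebraMap C (CurveRing C) (1 / 2) * w C *
          (s C + algebraMap C _ ((ε : ℤ) : C))) * (s C - algebraMap C _ ((ε : ℤ) : C)) := by
        linear_combination (algebraMap C (CurveRing C) (1 / 2)) * w_relation C
          - w C * h1 - 3 * algebraMap C (CurveRing C) (1 / 2) * w C * h2
      rw [this]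
      exact Ideal.mul_mem_left _ _ hs
    have key : Ideal.Quotient.mkₐ C J = (Algebra.ofId C (CurveRing C ⧸ J)).comp (evalPoint C ε) := by
      apply (AlgHom.cancel_right (mk_surjective C)).1
      apply MvPolynomial.algHom_ext
      intro i
      match i with
      | 0 =>
        change Ideal.Quotient.mk J (s C) = algebraMap C _ (evalPoint C ε (s C))
        rw [evalPoint_s]
        exact Ideal.Quotient.eq.2 hs
      | 1 =>
        change Ideal.Quotient.mk J (t C) = algebraMap C _ (evalPoint C ε (t C))
        rw [evalPoint_t, map_zero]
        exact Ideal.Quotient.eq_zero_iff_mem.2 ht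
      | 2 =>
        change Ideal.Quotient.mk J (w C) = algebraMap C _ (evalPoint C ε (w C))
        have : evalPoint C ε (w C) = 1 / 2 := by simp [evalPoint_mk, w]
        rw [this]
        exact Ideal.Quotient.eq.2 hw
    intro x hx
    rw [RingHom.mem_ker] at hx
    have := DFunLike.congr_fun key x
    rw [AlgHom.comp_apply, hx, map_zero] at this
    exact Ideal.Quotient.eq_zero_iff_mem.1 this
  · rw [hJ, Ideal.span_le]
    rintro _ (rfl | rfl)
    · simp [RingHom.mem_ker, evalPoint_s]
    · simp [RingHom.mem_ker, evalPoint_t]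

/-- The ID-ring `C[[t]]`, seen as an `S`-algebra through the embedding
`S → (S/𝔪)[[t]] ≅ C[[t]]` at `𝔪 = (s - ε, t)`, where `ε = ±1`. -/
def Expansion (_ε : ℤˣ) : Type u := PowerSeries C

namespace Expansion

variable (ε : ℤˣ)

instance : CommRing (Expansion C ε) := inferInstanceAs (CommRing (PowerSeries C))

instance : Inv (Expansion C ε) := inferInstanceAs (Inv (PowerSeries C))

instance : Algebra C (Expansion C ε) := inferInstanceAs (Algebra C (PowerSeries C))

instance : IDRing (Expansion C ε) := inferInstanceAs (IDRing (PowerSeries C))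

instance : IDConstAlgebra C (Expansion C ε) := inferInstanceAs (IDConstAlgebra C (PowerSeries C))

instance : Algebra (CurveRing C) (Expansion C ε) :=
  (taylorHom (evalPoint C ε)).toRingHom.toAlgebra

instance : IsScalarTower C (CurveRing C) (Expansion C ε) :=
  IsScalarTower.of_algebraMap_eq fun c => ((taylorHom (evalPoint C ε)).commutes c).symm

instance : IDAlgebra (CurveRing C) (Expansion C ε) where
  θ_algebraMap n x := taylorHom_θ (evalPoint C ε) n x

variable {C ε} in
/-- The value at `t = 0` of a power series. -/
def constCoeff : Expansion C ε →+* C := PowerSeries.constantCoeff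

end Expansion

end CurveRing

end

noncomputable section

/-! ### Iterative derivations and their first terms -/

section FirstTerm

/-! The map `f₁ ↦ s`, `f₂ ↦ t` identifies `M` with the ideal `(s, t)` of the elliptic curve `t² = s³
- s`. Since `t² = s(s² - 1)`, the square of this ideal is the principal ideal `(s)`, so a square
root of `s`, up to a unit of `C`, trivialises `M`. At the point `(ε, 0)` the series `ε s` has
constant term `1`, hence a square root `y` in `C[[t]]`. Put `z = t/y`. Then `y² = ε s`, `y z = t`,
`z² = ε(s² - 1)`, and with `w = 1/(3s² - 1)` the derivatives are `y' = ε w z`, `z' = 2 ε w s y`. So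
`R = S + S y + S z` is a ring stable under the derivation, and `f₁ ↦ y`, `f₂ ↦ ε z` is a horizontal
map `M → R`.

Everything rests on the identity `ε s y² - ε z² = 1`. It makes `R ⊗ M → R` an isomorphism, so `R` is
a solution ring. Conversely, a solution ring that maps to `C[[t]]` contains in its image all values
of horizontal maps, because the constants of `C[[t]]` are just `C`
(`IsSolutionRing.horizontal_mem_range`). This gives both minimality and uniqueness inside `C[[t]]`.
The ring `R` is ID-simple because it is a domain algebraic over `C[t]`: a non-zero ID-ideal contains
a non-zero polynomial in `t`, and one `θ n` turns that into its leading coefficient.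

Neither `s` nor `-s` is a square in the fraction field of `S`. Hence `1` and `y` are independent,
the rank is `2`, and `R = S ⊕ (S y + S z)` is graded by `ℤ/2`. An ID-automorphism `σ` of `R ⊗ D`
multiplies the odd part by `d = ε s y σ(y) - ε z σ(z)`. This element is constant, so it lies in `D`,
and the same identity forces `d² = 1`. Conversely every such `d` acts through the grading. Finally,
an `S`-isomorphism `R₁ ≅ R₋₁` would give a square root of `s` in `R₋₁`, and its value at `t = 0`
would be a square root of `-1` in `C`.

That `S` embeds in `C[[t]]` follows from the irreducibility of `Y³ - Y - X²` over `C[X]`. -/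

lemma IDRing.θ_one_apply_mul {R : Type*} [CommRing R] [IDRing R] (x y : R) :
    IDRing.θ 1 (x * y) = x * IDRing.θ 1 y + IDRing.θ 1 x * y := by
  rw [IDRing.θ_mul, Finset.Nat.sum_antidiagonal_eq_sum_range_succ_mk]
  simp [Finset.sum_range_succ, IDRing.θ_zero]

/-- The binomial coefficient in the iteration rule is `n + 1` here. Without torsion, `θ 1` therefore
determines all `θ n`, and later verifications need only the first derivative. -/
lemma IDRing.θ_succ {R : Type*} [CommRing R] [IDRing R] (n : ℕ) (x : R) :
    (n + 1) • IDRing.θ (n + 1) x = IDRing.θ 1 (IDRing.θ n x) := by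
  rw [IDRing.θ_comp, Nat.choose_one_right, add_comm n 1]

lemma IDModule.θ_succ (R : Type*) {M : Type*} [CommRing R] [IDRing R] [AddCommGroup M]
    [Module R M] [IDModule R M] (n : ℕ) (m : M) :
    (n + 1) • IDModule.θ R (n + 1) m = IDModule.θ R 1 (IDModule.θ R n m) := by
  rw [IDModule.θ_comp, Nat.choose_one_right, add_comm n 1]

/-- Without torsion, a map that commutes with `θ 1` commutes with every `θ n`. -/
lemma IDModule.map_θ_of_map_θ_one {S M A : Type*} [CommRing S] [IDRing S] [AddCommGroup M]
    [Module S M] [IDModule S M] [CommRing A] [IDRing A] [IsAddTorsionFree A] (f : M →+ A)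
    (h : ∀ m, f (IDModule.θ S 1 m) = IDRing.θ 1 (f m)) (n : ℕ) (m : M) :
    f (IDModule.θ S n m) = IDRing.θ n (f m) := by
  induction n with
  | zero => rw [IDModule.θ_zero, IDRing.θ_zero]
  | succ n ih =>
    apply nsmul_right_injective (n := n + 1) (Nat.succ_ne_zero n)
    simp only
    rw [← map_nsmul, IDModule.θ_succ, h, ih, IDRing.θ_succ]

/-- Without torsion, a map of ID-rings that commutes with `θ 1` commutes with every `θ n`. -/
lemma IDRing.map_θ_of_map_θ_one {B A : Type*} [CommRing B] [IDRing B] [CommRing A] [IDRing A]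
    [IsAddTorsionFree A] (f : B →+ A)
    (h : ∀ m, f (IDRing.θ 1 m) = IDRing.θ 1 (f m)) (n : ℕ) (m : B) :
    f (IDRing.θ n m) = IDRing.θ n (f m) := by
  induction n with
  | zero => rw [IDRing.θ_zero, IDRing.θ_zero]
  | succ n ih =>
    apply nsmul_right_injective (n := n + 1) (Nat.succ_ne_zero n)
    simp only
    rw [← map_nsmul, IDRing.θ_succ, h, ih, IDRing.θ_succ]

/-- Over a field of characteristic zero, a subspace stable under `θ 1` is stable under `θ n`. -/
lemma IDRing.θ_mem_of_θ_one_mem (C : Type*) {A : Type*} [Field C] [CharZero C] [CommRing A]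
    [IDRing A] [Algebra C A] (N : Submodule C A) (h : ∀ x ∈ N, IDRing.θ 1 x ∈ N) (n : ℕ) :
    ∀ x ∈ N, IDRing.θ n x ∈ N := by
  induction n with
  | zero => intro x hx; rwa [IDRing.θ_zero]
  | succ n ih =>
    intro x hx
    have h1 := h _ (ih x hx)
    rw [← IDRing.θ_succ, ← Nat.cast_smul_eq_nsmul C] at h1
    exact (N.smul_mem_iff (Nat.cast_ne_zero.2 (Nat.succ_ne_zero n))).1 h1

end FirstTerm

/-! ### Horizontal maps into ID-algebras and solution rings -/

section Pairing

variable {S M R A : Type*} [CommRing S] [IDRing S] [AddCommGroup M] [Module S M] [IDModule S M]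
  [CommRing R] [IDRing R] [Algebra S R] [IDAlgebra S R]
  [CommRing A] [IDRing A] [Algebra S A]

/-- The map `R ⊗ M → A`, `r ⊗ m ↦ g r * μ m`. -/
def tensorPairing (g : R →ₐ[S] A) (μ : M →ₗ[S] A) : R ⊗[S] M →ₗ[S] A :=
  LinearMap.mul' S A ∘ₗ TensorProduct.map g.toLinearMap μ

@[simp]
lemma tensorPairing_tmul (g : R →ₐ[S] A) (μ : M →ₗ[S] A) (r : R) (m : M) :
    tensorPairing g μ (r ⊗ₜ m) = g r * μ m := by
  simp [tensorPairing]

lemma tensorPairing_smul (g : R →ₐ[S] A) (μ : M →ₗ[S] A) (r : R) (x : R ⊗[S] M) :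
    tensorPairing g μ (r • x) = g r * tensorPairing g μ x := by
  induction x using TensorProduct.induction_on with
  | zero => simp
  | add x y hx hy => rw [smul_add, map_add, map_add, hx, hy, mul_add]
  | tmul a m => simp [TensorProduct.smul_tmul', mul_assoc]

lemma tensorPairing_θ (g : R →ₐ[S] A) (hg : ∀ n x, g (IDRing.θ n x) = IDRing.θ n (g x))
    (μ : M →ₗ[S] A) (hμ : ∀ n m, μ (IDModule.θ S n m) = IDRing.θ n (μ m)) (n : ℕ)
    (x : R ⊗[S] M) :
    tensorPairing g μ (tensorθ S M R n x) = IDRing.θ n (tensorPairing g μ x) := by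
  induction x using TensorProduct.induction_on with
  | zero => simp
  | add x y hx hy => simp only [map_add, hx, hy]
  | tmul a m => simp [tensorθ_tmul, IDRing.θ_mul, hg, hμ]

/-- The values of a horizontal map `M → A` lie in the image of every solution ring whose image
contains the constants of `A`. -/
lemma IsSolutionRing.horizontal_mem_range (h : IsSolutionRing S M R) (g : R →ₐ[S] A)
    (hg : ∀ n x, g (IDRing.θ n x) = IDRing.θ n (g x))
    (hc : ∀ c ∈ IDRing.constants A, c ∈ g.range)
    (μ : M →ₗ[S] A) (hμ : ∀ n m, μ (IDModule.θ S n m) = IDRing.θ n (μ m)) (m : M) :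
    μ m ∈ g.range := by
  have key : ∀ x : R ⊗[S] M, tensorPairing g μ x ∈ g.range := by
    intro x
    -- For a solution ring, `R ⊗ M` is spanned over `R` by constants. The pairing is horizontal, so
    -- it sends constants to constants of `A`.
    induction x using h.2.inductionOn with
    | zero => rw [map_zero]; exact zero_mem _
    | tmul z =>
      refine hc _ fun n hn => ?_
      rw [← tensorPairing_θ g hg μ hμ, Submodule.subtype_apply, z.2 n hn, map_zero]
    | smul r x hx =>
      rw [tensorPairing_smul]
      exact mul_mem ⟨r, rfl⟩ hx
    | add x y hx hy => rw [map_add]; exact add_mem hx hy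
  simpa using key (1 ⊗ₜ m)

/-- If a horizontal map `M → R` identifies `R ⊗ M` with `R`, then `R` is a solution ring. -/
lemma isSolutionRing_of_horizontal [Nontrivial R] (μ : M →ₗ[S] R)
    (hμ : ∀ n m, μ (IDModule.θ S n m) = IDRing.θ n (μ m)) (e : R ⊗[S] M)
    (he : tensorPairing (AlgHom.id S R) μ e = 1) (h : ∀ m, (1 : R) ⊗ₜ[S] m = μ m • e) :
    IsSolutionRing S M R := by
  refine ⟨inferInstance, ?_⟩
  set Ψ := tensorPairing (AlgHom.id S R) μ with hΨ
  have hsmul : ∀ (r : R) x, Ψ (r • x) = r * Ψ x := tensorPairing_smul (AlgHom.id S R) μ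
  have hθ : ∀ n x, Ψ (tensorθ S M R n x) = IDRing.θ n (Ψ x) :=
    tensorPairing_θ (AlgHom.id S R) (fun _ _ => rfl) μ hμ
  -- The map `r ↦ r • e` is inverse to the pairing, so `R ⊗ M` is free of rank one on `e`. As the
  -- pairing is injective and horizontal with `Ψ e = 1`, the generator `e` is itself constant.
  have hx : ∀ x, Ψ x • e = x := by
    intro x
    induction x using TensorProduct.induction_on with
    | zero => simp
    | add x y hx hy => rw [map_add, add_smul, hx, hy]
    | tmul r m =>
      have : (r ⊗ₜ[S] m : R ⊗[S] M) = r • (1 ⊗ₜ m) := by simp [TensorProduct.smul_tmul']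
      rw [this, hsmul, mul_smul, h, hsmul, he, mul_one]
  have hinj : ∀ x, Ψ x = 0 → x = 0 := fun x h0 => by rw [← hx x, h0, zero_smul]
  let eN : (R ⊗[S] M) ≃ₗ[R] R :=
    { toFun := Ψ
      map_add' := map_add _
      map_smul' := hsmul
      invFun := fun r => r • e
      left_inv := hx
      right_inv := fun r => by rw [hsmul, he, mul_one] }
  let eM : tensorConstants S M R ≃ₗ[IDRing.constants R] IDRing.constants R :=
    { toFun := fun z => ⟨Ψ z, fun n hn => by rw [← hθ, z.2 n hn, map_zero]⟩
      map_add' := fun x y => Subtype.ext (map_add Ψ _ _)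
      map_smul' := fun c x => Subtype.ext (hsmul _ _)
      invFun := fun c => ⟨(c : R) • e, fun n hn => hinj _ (by
        rw [hθ, hsmul, he, mul_one]; exact c.2 n hn)⟩
      left_inv := fun z => Subtype.ext (hx z)
      right_inv := fun c => Subtype.ext (by
        change Ψ ((c : R) • e) = c
        rw [hsmul, he, mul_one]) }
  -- Under both equivalences the inclusion of the constants of `R ⊗ M` becomes `C_R → R`, for which
  -- base change to `R` is trivial.
  exact (IsBaseChange.iff_of_equiv_comm eM eN (LinearMap.ext fun _ => rfl)).2
    (IsBaseChange.linearMap (IDRing.constants R) R)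

end Pairing

/-! ### Polynomial preliminaries -/

section PolynomialPreliminaries

open Polynomial

variable {C : Type*} [Field C]

/-- If `g` has a simple root, then `P² g = c Q²` only for `P = Q = 0`. -/
lemma Polynomial.eq_zero_of_sq_mul_eq_sq {P Q g h : C[X]} {a c : C} (hc : c ≠ 0)
    (hg : g = (X - Polynomial.C a) * h) (hh : h.eval a ≠ 0)
    (e : P ^ 2 * g = Polynomial.C c * Q ^ 2) : P = 0 ∧ Q = 0 := by
  have hh0 : h ≠ 0 := by rintro rfl; simp at hh
  have hg0 : g ≠ 0 := by rw [hg]; exact mul_ne_zero (X_sub_C_ne_zero a) hh0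
  have hC : Polynomial.C c ≠ 0 := Polynomial.C_ne_zero.2 hc
  have hiff : P = 0 ↔ Q = 0 := by
    constructor
    · rintro rfl
      simpa [hC, hc] using e.symm
    · rintro rfl
      simpa [hg0] using e
  by_cases hP : P = 0
  · exact ⟨hP, hiff.1 hP⟩
  · exfalso
    have hQ : Q ≠ 0 := fun h => hP (hiff.2 h)
    -- The multiplicity of the root `a` is odd on the left and even on the right.
    have e' := congrArg (rootMultiplicity a) e
    have h1 : rootMultiplicity a g = 1 := by
      rw [hg, rootMultiplicity_mul (by rw [← hg]; exact hg0), rootMultiplicity_X_sub_C_self,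
        rootMultiplicity_eq_zero hh]
    rw [rootMultiplicity_mul (mul_ne_zero (pow_ne_zero _ hP) hg0),
      rootMultiplicity_mul (mul_ne_zero hC (pow_ne_zero _ hQ)), rootMultiplicity_C, h1,
      pow_two, pow_two, rootMultiplicity_mul (mul_ne_zero hP hP),
      rootMultiplicity_mul (mul_ne_zero hQ hQ)] at e'
    omega

/-- The cubic `Y³ - Y - X²` over `C[X]`. -/
def curveCubic (C : Type*) [Field C] : C[X][X] := X ^ 3 - X - Polynomial.C (X ^ 2)

lemma curveCubic_natDegree : (curveCubic C).natDegree = 3 := by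
  unfold curveCubic; compute_degree!

lemma curveCubic_monic : (curveCubic C).Monic := by
  unfold curveCubic; monicity!

/-- A monic cubic over a domain is irreducible once it has no root. A root `p` would satisfy `p³ - p
= X²`, but the left side has degree `0` or a multiple of `3`. -/
lemma curveCubic_irreducible : Irreducible (curveCubic C) := by
  rw [curveCubic_monic.irreducible_iff_roots_eq_zero_of_degree_le_three
    (by rw [curveCubic_natDegree]; norm_num) (by rw [curveCubic_natDegree])]
  rw [Multiset.eq_zero_iff_forall_notMem]
  intro p hp
  rw [mem_roots curveCubic_monic.ne_zero] at hp
  have e : p ^ 3 - p = X ^ 2 := by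
    have : p ^ 3 - p - X ^ 2 = 0 := by simpa [curveCubic] using hp
    exact sub_eq_zero.1 this
  have e2 := congrArg natDegree e
  rw [natDegree_X_pow] at e2
  rcases Nat.eq_zero_or_pos p.natDegree with h | h
  · obtain ⟨c, rfl⟩ := natDegree_eq_zero.1 h
    rw [← map_pow, ← map_sub, natDegree_C] at e2
    omega
  · rw [natDegree_sub_eq_left_of_natDegree_lt (by rw [natDegree_pow]; omega), natDegree_pow] at e2
    omega

/-- Over a domain containing `C[X]`, a root of `Y³ - Y - X²` satisfies no other relations. -/
lemma curveCubic_dvd {B : Type*} [CommRing B] [IsDomain B] (f : C[X] →+* B)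
    (hf : Function.Injective f) (σ : B) (h : σ ^ 3 - σ = f X ^ 2) (P : C[X][X])
    (hP : P.eval₂ f σ = 0) : curveCubic C ∣ P := by
  let _ := f.toAlgebra
  have : FaithfulSMul C[X] B := (faithfulSMul_iff_algebraMap_injective C[X] B).2 hf
  have hσ : aeval σ (curveCubic C) = 0 := by
    have : algebraMap C[X] B X = f X := rfl
    simp [curveCubic, this, h]
  have hint : IsIntegral C[X] σ := ⟨curveCubic C, curveCubic_monic, hσ⟩
  -- Since `C[X]` is integrally closed, the minimal polynomial of an integral element divides every
  -- polynomial over `C[X]` that kills it, without passing to fractions.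
  have h1 : minpoly C[X] σ ∣ curveCubic C := minpoly.isIntegrallyClosed_dvd hint hσ
  have h2 : minpoly C[X] σ ∣ P := minpoly.isIntegrallyClosed_dvd hint hP
  have h3 : Associated (minpoly C[X] σ) (curveCubic C) :=
    (curveCubic_irreducible.dvd_iff.1 h1).resolve_left
      (minpoly.prime_of_isIntegrallyClosed hint).not_isUnit |>.symm
  exact h3.symm.dvd.trans h2

end PolynomialPreliminaries

/-! ### The embeddings of `S` into `C[[t]]` -/

namespace CurveRing

variable (C : Type u) [Field C] [CharZero C]

lemma θ_one_eq_deriv (x : CurveRing C) : IDRing.θ 1 x = deriv C x := by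
  change dividedPow (deriv C).toLinearMap 1 x = _
  simp [dividedPow]

lemma isUnit_three_s_sq_sub_one : IsUnit (3 * s C ^ 2 - 1) :=
  IsUnit.of_mul_eq_one (w C) (by rw [mul_comm]; exact w_relation C)

/-- Induction on elements of `S`. -/
lemma induction_on {P : CurveRing C → Prop} (x : CurveRing C)
    (hC : ∀ c, P (algebraMap C _ c)) (hs : P (s C)) (ht : P (t C)) (hw : P (w C))
    (hadd : ∀ x y, P x → P y → P (x + y)) (hmul : ∀ x y, P x → P y → P (x * y)) : P x := by
  obtain ⟨p, rfl⟩ := mk_surjective C x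
  induction p using MvPolynomial.induction_on with
  | C c => exact hC c
  | add p q hp hq => rw [map_add]; exact hadd _ _ hp hq
  | mul_X p i hp =>
    rw [map_mul]
    refine hmul _ _ hp ?_
    match i with
    | 0 => exact hs
    | 1 => exact ht
    | 2 => exact hw

open Polynomial in
/-- Up to powers of `3s² - 1`, an element of `S` has the form `p(s) + q(s) t`. -/
lemma exists_mul_pow_eq (x : CurveRing C) : ∃ (k : ℕ) (p q : C[X]),
    x * (3 * s C ^ 2 - 1) ^ k = aeval (s C) p + aeval (s C) q * t C := by
  have hv : aeval (s C) (3 * X ^ 2 - 1 : C[X]) = 3 * s C ^ 2 - 1 := by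
    simp [map_ofNat (aeval (s C) : C[X] →ₐ[C] CurveRing C) 3]
  have ht : aeval (s C) (X ^ 3 - X : C[X]) = t C ^ 2 := by
    simp only [map_sub, map_pow, aeval_X]
    linear_combination s_t_relation C
  induction x using induction_on with
  | hC c => exact ⟨0, Polynomial.C c, 0, by simp⟩
  | hs => exact ⟨0, X, 0, by simp⟩
  | ht => exact ⟨0, 0, 1, by simp⟩
  | hw => exact ⟨1, 1, 0, by simpa using w_relation C⟩
  | hadd x y hx hy =>
    obtain ⟨k, p, q, hx⟩ := hx
    obtain ⟨l, p', q', hy⟩ := hy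
    refine ⟨k + l, p * (3 * X ^ 2 - 1) ^ l + p' * (3 * X ^ 2 - 1) ^ k,
      q * (3 * X ^ 2 - 1) ^ l + q' * (3 * X ^ 2 - 1) ^ k, ?_⟩
    simp only [map_add, map_mul, map_pow, hv]
    linear_combination (3 * s C ^ 2 - 1) ^ l * hx + (3 * s C ^ 2 - 1) ^ k * hy
  | hmul x y hx hy =>
    obtain ⟨k, p, q, hx⟩ := hx
    obtain ⟨l, p', q', hy⟩ := hy
    refine ⟨k + l, p * p' + q * q' * (X ^ 3 - X), p * q' + q * p', ?_⟩
    simp only [map_add, map_mul, ht]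
    rw [pow_add, mul_mul_mul_comm, hx, hy]
    ring

end CurveRing

namespace Expansion

open CurveRing

variable (C : Type u) [Field C] [CharZero C] (ε : ℤˣ)

instance : IsDomain (Expansion C ε) := inferInstanceAs (IsDomain (PowerSeries C))

instance : CharZero (Expansion C ε) := 
  charZero_of_injective_algebraMap (algebraMap C (Expansion C ε)).injective

/-- The iterative derivation of `C[[t]]` starts with the usual derivative. -/
lemma θ_one_eq_derivative (x : Expansion C ε) :
    IDRing.θ 1 x = PowerSeries.derivative C (show PowerSeries C from x) := by
  change dividedPow (PowerSeries.derivative C).toLinearMap 1 x = _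
  simp [dividedPow]

variable {C ε} in
/-- A power series is determined by its derivative and its value at `t = 0`. -/
lemma ext_of_θ_one {x y : Expansion C ε} (h : IDRing.θ 1 x = IDRing.θ 1 y)
    (h0 : constCoeff x = constCoeff y) : x = y := by
  rw [θ_one_eq_derivative, θ_one_eq_derivative] at h
  exact PowerSeries.derivative.ext h h0

lemma θ_one_algebraMap (x : CurveRing C) :
    IDRing.θ 1 (algebraMap (CurveRing C) (Expansion C ε) x)
      = algebraMap (CurveRing C) (Expansion C ε) (deriv C x) := by
  rw [IDAlgebra.θ_algebraMap, θ_one_eq_deriv]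

lemma constCoeff_algebraMap (x : CurveRing C) :
    constCoeff (algebraMap (CurveRing C) (Expansion C ε) x) = evalPoint C ε x := by
  change PowerSeries.constantCoeff (PowerSeries.mk fun n => evalPoint C ε (IDRing.θ n x)) = _
  rw [← PowerSeries.coeff_zero_eq_constantCoeff_apply, PowerSeries.coeff_mk, IDRing.θ_zero]

lemma constCoeff_algebraMap_base (c : C) :
    constCoeff (algebraMap C (Expansion C ε) c) = c := by
  rw [IsScalarTower.algebraMap_apply C (CurveRing C), constCoeff_algebraMap, AlgHom.commutes]
  rfl

/-- The constants of `C[[t]]` are the elements of `C`. -/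
lemma eq_algebraMap_of_θ_one_eq_zero {x : Expansion C ε} (h : IDRing.θ 1 x = 0) :
    x = algebraMap C _ (constCoeff x) := by
  apply ext_of_θ_one
  · rw [h, IDConstAlgebra.θ_algebraMap_eq_zero 1 one_pos]
  · rw [constCoeff_algebraMap_base]

lemma algebraMap_t :
    algebraMap (CurveRing C) (Expansion C ε) (t C) = (PowerSeries.X : PowerSeries C) := by
  apply ext_of_θ_one
  · rw [θ_one_algebraMap, deriv_t, map_one]
    exact ((θ_one_eq_derivative C ε _).trans (PowerSeries.derivative_X (R := C))).symm
  · rw [constCoeff_algebraMap, evalPoint_t]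
    exact PowerSeries.constantCoeff_X.symm

lemma aeval_algebraMap_t (p : Polynomial C) :
    Polynomial.aeval (algebraMap (CurveRing C) (Expansion C ε) (t C)) p
      = (p : PowerSeries C) := by
  rw [algebraMap_t]
  have h : (Polynomial.aeval (PowerSeries.X : PowerSeries C))
      = Polynomial.coeToPowerSeries.algHom (R := C) C := by
    ext; simp [Polynomial.coeToPowerSeries.algHom]
  exact (DFunLike.congr_fun h p).trans (by simp [Polynomial.coeToPowerSeries.algHom])

lemma aeval_algebraMap_t_injective : Function.Injective
    (Polynomial.aeval (R := C) (algebraMap (CurveRing C) (Expansion C ε) (t C))) := by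
  intro p q h
  rw [aeval_algebraMap_t, aeval_algebraMap_t] at h
  exact Polynomial.coe_injective C h

open Polynomial in
-- Up to a unit, an element of `S` is the value of a polynomial `P = p(Y) + q(Y) X` at `Y = s`, `X =
-- t`. If it vanishes in `C[[t]]`, where `t` is transcendental, then the cubic divides `P`, and the
-- cubic already vanishes in `S`. No domain property of `S` is needed; that property is a
-- consequence.
lemma algebraMap_injective : Function.Injective (algebraMap (CurveRing C) (Expansion C ε)) := by
  rw [injective_iff_map_eq_zero]
  intro x hx
  obtain ⟨k, p, q, h⟩ := exists_mul_pow_eq C x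
  set P : C[X][X] := p.map Polynomial.C + q.map Polynomial.C * Polynomial.C X with hP
  have hS : P.eval₂ (aeval (t C) : C[X] →ₐ[C] CurveRing C).toRingHom (s C)
      = aeval (s C) p + aeval (s C) q * t C := by
    have hc : (aeval (t C) : C[X] →ₐ[C] CurveRing C).toRingHom.comp Polynomial.C
        = algebraMap C (CurveRing C) := by ext; simp
    rw [hP, eval₂_add, eval₂_mul, eval₂_map, eval₂_map, hc, eval₂_C]
    simp [aeval_def]
  set f : C[X] →+* Expansion C ε := (algebraMap (CurveRing C) (Expansion C ε)).comp
    (aeval (t C) : C[X] →ₐ[C] CurveRing C).toRingHom with hf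
  have hfa : ∀ r, f r = aeval (algebraMap (CurveRing C) (Expansion C ε) (t C)) r := fun r => by
    simp [hf, aeval_algebraMap_apply]
  have hfi : Function.Injective f := fun a b hab => by
    rw [hfa, hfa] at hab
    exact aeval_algebraMap_t_injective C ε hab
  have hdvd : curveCubic C ∣ P := by
    refine curveCubic_dvd f hfi (algebraMap (CurveRing C) (Expansion C ε) (s C)) ?_ P ?_
    · have : f X = algebraMap (CurveRing C) (Expansion C ε) (t C) := by simp [hf]
      rw [this, ← map_pow, ← map_pow, ← map_sub]
      congr 1
      linear_combination s_t_relation C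
    · rw [hf, ← hom_eval₂, hS, ← h, map_mul, hx, zero_mul]
  obtain ⟨Q, hQ⟩ := hdvd
  have h0 : (curveCubic C).eval₂ (aeval (t C) : C[X] →ₐ[C] CurveRing C).toRingHom (s C) = 0 := by
    simp only [curveCubic, eval₂_sub, eval₂_pow, eval₂_X, eval₂_C]
    simpa using s_t_relation C
  rw [← hS, hQ, eval₂_mul, h0, zero_mul] at h
  exact ((isUnit_three_s_sq_sub_one C).pow k).mul_left_eq_zero.1 h

end Expansion

/-! ### Constants of `S` and the square classes of `s` and `-s` -/

namespace CurveRing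

variable (C : Type u) [Field C] [CharZero C]

instance : IsDomain (CurveRing C) :=
  (Expansion.algebraMap_injective C 1).isDomain (algebraMap (CurveRing C) (Expansion C 1))

/-- The constants of `S` are `C`. -/
lemma constants_eq : IDRing.constants (CurveRing C) = (algebraMap C (CurveRing C)).range := by
  ext x
  constructor
  · intro hx
    -- A constant of `S` is a constant series in `C[[t]]`, so it equals its value at the point `(1,
    -- 0)`.
    refine ⟨evalPoint C 1 x, Expansion.algebraMap_injective C 1 ?_⟩
    rw [← IsScalarTower.algebraMap_apply, ← Expansion.constCoeff_algebraMap C 1]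
    refine (Expansion.eq_algebraMap_of_θ_one_eq_zero C 1 ?_).symm
    rw [IDAlgebra.θ_algebraMap, hx 1 one_pos, map_zero]
  · rintro ⟨c, rfl⟩ n hn
    exact IDConstAlgebra.θ_algebraMap_eq_zero n hn c

lemma s_ne_zero : s C ≠ 0 := fun h => by
  have := evalPoint_s C 1
  rw [h, map_zero] at this
  simp at this

open Polynomial in
/-- The element `s` is transcendental over `C`. -/
lemma aeval_s_injective : Function.Injective (aeval (R := C) (s C)) := by
  rw [← transcendental_iff_injective]
  intro hs
  -- If `s` were algebraic over `C`, so would be `t² = s³ - s`, but `t` becomes the variable of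
  -- `C[[t]]`.
  have ht : IsAlgebraic C (t C ^ 2) := by
    have : t C ^ 2 = s C ^ 3 - s C := by linear_combination - s_t_relation C
    rw [this]
    exact (hs.pow 3).sub hs
  have ht' : IsAlgebraic C (algebraMap (CurveRing C) (Expansion C 1) (t C)) :=
    (IsAlgebraic.of_pow two_pos ht).algebraMap
  exact transcendental_iff_injective.2 (Expansion.aeval_algebraMap_t_injective C 1) ht'

open Polynomial in
/-- The elements `1` and `t` are linearly independent over `C[s]`. -/
lemma aeval_s_add_mul_t_eq_zero {p q : C[X]} (h : aeval (s C) p + aeval (s C) q * t C = 0) :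
    p = 0 ∧ q = 0 := by
  -- Multiplication by the conjugate `q t - p` gives the vanishing of the norm, an equation in
  -- `C[s]` alone. The simple root `0` of `X³ - X` then decides.
  have e : q ^ 2 * (X ^ 3 - X) = Polynomial.C 1 * p ^ 2 := by
    apply aeval_s_injective C
    simp only [map_mul, map_pow, map_sub, aeval_X, map_one, one_mul]
    linear_combination (aeval (s C) q * t C - aeval (s C) p) * h
      + aeval (s C) q ^ 2 * s_t_relation C
  exact (Polynomial.eq_zero_of_sq_mul_eq_sq (a := 0) (h := X ^ 2 - 1) one_ne_zero
    (by simp; ring) (by simp) e).symm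

open Polynomial in
/-- The elements `s` and `-s` are not squares in the quotient field of `S`. -/
lemma eq_zero_of_sq_eq_mul_sq (ε : ℤˣ) {a b : CurveRing C}
    (h : a ^ 2 = ((ε : ℤ) : CurveRing C) * s C * b ^ 2) : b = 0 := by
  have hε : ((ε : ℤ) : C) ≠ 0 := by
    rcases Int.units_eq_one_or ε with rfl | rfl <;> simp
  have hεS : aeval (s C) (Polynomial.C ((ε : ℤ) : C)) = ((ε : ℤ) : CurveRing C) := by simp
  obtain ⟨k, p, q, ha⟩ := exists_mul_pow_eq C a
  obtain ⟨l, u, r, hb⟩ := exists_mul_pow_eq C b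
  set V : CurveRing C := 3 * s C ^ 2 - 1 with hV
  have hv : aeval (s C) (3 * X ^ 2 - 1 : C[X]) = V := by
    simp [hV, map_ofNat (aeval (s C) : C[X] →ₐ[C] CurveRing C) 3]
  have hst := s_t_relation C
  -- A common power of `3s² - 1` clears the denominators of `a` and `b`.
  obtain ⟨p', q', ha'⟩ : ∃ p' q' : C[X],
      a * V ^ (k + l) = aeval (s C) p' + aeval (s C) q' * t C :=
    ⟨p * (3 * X ^ 2 - 1) ^ l, q * (3 * X ^ 2 - 1) ^ l, by
      simp only [map_mul, map_pow, hv]; linear_combination V ^ l * ha⟩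
  obtain ⟨u', r', hb'⟩ : ∃ u' r' : C[X],
      b * V ^ (k + l) = aeval (s C) u' + aeval (s C) r' * t C :=
    ⟨u * (3 * X ^ 2 - 1) ^ k, r * (3 * X ^ 2 - 1) ^ k, by
      simp only [map_mul, map_pow, hv]; linear_combination V ^ k * hb⟩
  have h' : (a * V ^ (k + l)) ^ 2
      = ((ε : ℤ) : CurveRing C) * s C * (b * V ^ (k + l)) ^ 2 := by
    linear_combination V ^ (k + l) * V ^ (k + l) * h
  rw [ha', hb'] at h'
  -- Multiplying numerator and denominator of `a/b` by the conjugate `u' - r' t` gives `a/b = (α + β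
  -- t)/N` with `N` in `C[s]`. The square of this is to be `ε s`, so `(α + β t)² = ε s N²`, and the
  -- coefficients of `1` and `t` can be compared.
  set α := p' * u' - q' * r' * (X ^ 3 - X) with hα
  set β := q' * u' - p' * r' with hβ
  set N := u' ^ 2 - r' ^ 2 * (X ^ 3 - X) with hN
  have key := aeval_s_add_mul_t_eq_zero C
    (p := α ^ 2 + β ^ 2 * (X ^ 3 - X) - Polynomial.C ((ε : ℤ) : C) * X * N ^ 2)
    (q := 2 * α * β) (by
      have hf : aeval (s C) (X ^ 3 - X : C[X]) = t C ^ 2 := by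
        simp only [map_sub, map_pow, aeval_X]
        linear_combination hst
      simp only [hα, hβ, hN, map_add, map_sub, map_mul, map_pow, hf, hεS, map_ofNat, aeval_X] at *
      linear_combination (aeval (s C) u' - aeval (s C) r' * t C) ^ 2 * h')
  have hN0 : N = 0 := by
    obtain ⟨k1, k2⟩ := key
    -- If `α = 0`, cancelling `X` leaves `β²(X² - 1) = ε N²`, excluded for `N ≠ 0` by the simple
    -- root `1`. If `β = 0`, then `α² = ε X N²`, excluded by the simple root `0`.
    rcases mul_eq_zero.1 k2 with h2 | h2
    · have hα0 : α = 0 := by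
        rcases mul_eq_zero.1 h2 with h2 | h2
        · exact absurd h2 two_ne_zero
        · exact h2
      rw [hα0] at k1
      refine (Polynomial.eq_zero_of_sq_mul_eq_sq (P := β) (g := X ^ 2 - 1) (a := 1)
        (h := X + 1) hε (by rw [Polynomial.C_1]; ring) (by norm_num) ?_).2
      apply mul_left_cancel₀ (X_ne_zero (R := C))
      linear_combination k1
    · rw [h2] at k1
      refine (Polynomial.eq_zero_of_sq_mul_eq_sq (P := N) (g := X) (a := 0)
        (h := 1) (c := ((ε : ℤ) : C)⁻¹) (Q := α) (inv_ne_zero hε) (by simp) (by simp) ?_).1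
      have hC : Polynomial.C (((ε : ℤ) : C)⁻¹) * Polynomial.C ((ε : ℤ) : C) = 1 := by
        rw [← Polynomial.C_mul, inv_mul_cancel₀ hε, Polynomial.C_1]
      linear_combination - Polynomial.C (((ε : ℤ) : C)⁻¹) * k1 - X * N ^ 2 * hC
  -- `N` is the norm of `u' + r' t`, and a vanishing norm forces both coefficients to vanish.
  have hru := Polynomial.eq_zero_of_sq_mul_eq_sq (P := r') (Q := u') (g := X ^ 3 - X) (a := 0)
    (h := X ^ 2 - 1) (c := 1) one_ne_zero (by simp; ring) (by simp)
    (by rw [Polynomial.C_1]; linear_combination - hN0)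
  rw [hru.1, hru.2] at hb'
  simp only [map_zero, zero_mul, add_zero] at hb'
  exact ((isUnit_three_s_sq_sub_one C).pow _).mul_left_eq_zero.1 hb'

end CurveRing

/-! ### The square root of `ε s` and the ring it generates -/

/-- Substitute `f - 1`, which has no constant term, into the binomial series `(1 + X)^(1/2)`. The
constant term of the result squares to `1`, so a sign normalises it. -/
lemma PowerSeries.exists_sq_eq {C : Type*} [Field C] [CharZero C] (f : PowerSeries C)
    (hf : PowerSeries.constantCoeff f = 1) :
    ∃ g : PowerSeries C, g ^ 2 = f ∧ PowerSeries.constantCoeff g = 1 := by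
  have hs : PowerSeries.HasSubst (f - 1) :=
    PowerSeries.HasSubst.of_constantCoeff_zero' (by rw [map_sub, hf, map_one, sub_self])
  obtain ⟨g, hg⟩ : ∃ g : PowerSeries C, g ^ 2 = f := by
    refine ⟨(PowerSeries.binomialSeries C (1 / 2 : ℚ)).subst (f - 1), ?_⟩
    have h2 : PowerSeries.binomialSeries C (1 / 2 : ℚ) ^ 2 = 1 + PowerSeries.X := by
      rw [pow_two, ← PowerSeries.binomialSeries_add]
      have := PowerSeries.binomialSeries_nat (R := ℚ) (A := C) 1
      norm_num at this ⊢
      exact this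
    rw [← PowerSeries.subst_pow hs, h2, PowerSeries.subst_add hs, PowerSeries.subst_X hs,
      ← PowerSeries.coe_substAlgHom hs, map_one]
    ring
  have h1 : PowerSeries.constantCoeff g ^ 2 = 1 := by rw [← map_pow, hg, hf]
  rcases sq_eq_sq_iff_eq_or_eq_neg.1 (h1.trans (one_pow 2).symm) with h | h
  · exact ⟨g, hg, h⟩
  · exact ⟨-g, by rw [neg_sq, hg], by rw [map_neg, h, neg_neg]⟩

namespace Expansion

open CurveRing

variable (C : Type u) [Field C] [CharZero C] (ε : ℤˣ)

lemma units_sq (B : Type*) [CommRing B] : ((ε : ℤ) : B) ^ 2 = 1 := by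
  rcases Int.units_eq_one_or ε with rfl | rfl <;> simp

lemma exists_root : ∃ y : Expansion C ε,
    y ^ 2 = algebraMap (CurveRing C) (Expansion C ε) (((ε : ℤ) : CurveRing C) * s C) ∧
    constCoeff y = 1 := by
  refine PowerSeries.exists_sq_eq (C := C) _ ?_
  refine (constCoeff_algebraMap C ε _).trans ?_
  rw [map_mul, evalPoint_s, map_intCast, ← pow_two, units_sq]

/-- The square root of `ε s` with constant term `1`. -/
def root : Expansion C ε := (exists_root C ε).choose

/-- The series `t / √(ε s)`. -/
def coroot : Expansion C ε :=
  algebraMap (CurveRing C) (Expansion C ε) (t C) * (root C ε)⁻¹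

lemma root_sq : root C ε ^ 2
    = algebraMap (CurveRing C) (Expansion C ε) (((ε : ℤ) : CurveRing C) * s C) :=
  (exists_root C ε).choose_spec.1

lemma constCoeff_root : constCoeff (root C ε) = 1 := (exists_root C ε).choose_spec.2

lemma root_ne_zero : root C ε ≠ 0 := fun h => by
  have := constCoeff_root C ε
  rw [h, map_zero] at this
  exact zero_ne_one this

lemma root_mul_coroot : root C ε * coroot C ε = algebraMap (CurveRing C) _ (t C) := by
  -- The inverse of a power series is a true inverse only when the constant term is non-zero.
  have h : root C ε * (root C ε)⁻¹ = 1 :=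
    PowerSeries.mul_inv_cancel (k := C) (root C ε)
      (by rw [show PowerSeries.constantCoeff (root C ε) = 1 from constCoeff_root C ε]
          exact one_ne_zero)
  rw [coroot]
  linear_combination algebraMap (CurveRing C) _ (t C) * h

lemma algebraMap_s_t_relation :
    algebraMap (CurveRing C) (Expansion C ε) (s C) ^ 3
      - algebraMap (CurveRing C) (Expansion C ε) (s C)
      - algebraMap (CurveRing C) (Expansion C ε) (t C) ^ 2 = 0 := by
  rw [← map_pow, ← map_pow, ← map_sub, ← map_sub, s_t_relation, map_zero]

lemma algebraMap_w_relation :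
    algebraMap (CurveRing C) (Expansion C ε) (w C)
      * (3 * algebraMap (CurveRing C) (Expansion C ε) (s C) ^ 2 - 1) = 1 := by
  have h := congrArg (algebraMap (CurveRing C) (Expansion C ε)) (w_relation C)
  simpa only [map_mul, map_sub, map_pow, map_one, map_ofNat] using h

lemma root_sq' : root C ε ^ 2
    = ((ε : ℤ) : Expansion C ε) * algebraMap (CurveRing C) (Expansion C ε) (s C) := by
  rw [root_sq, map_mul, map_intCast]

lemma coroot_sq : coroot C ε ^ 2
    = ((ε : ℤ) : Expansion C ε) * (algebraMap (CurveRing C) (Expansion C ε) (s C) ^ 2 - 1) := by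
  apply mul_left_cancel₀ (pow_ne_zero 2 (root_ne_zero C ε))
  rw [← mul_pow, root_mul_coroot, root_sq']
  linear_combination - algebraMap_s_t_relation C ε
    - algebraMap (CurveRing C) (Expansion C ε) (s C)
      * (algebraMap (CurveRing C) (Expansion C ε) (s C) ^ 2 - 1) * units_sq ε (Expansion C ε)

lemma θ_one_intCast (n : ℤ) : IDRing.θ 1 (n : Expansion C ε) = 0 := by
  rw [← map_intCast (algebraMap C (Expansion C ε)) n]
  exact IDConstAlgebra.θ_algebraMap_eq_zero 1 one_pos _

/-- Differentiating `y² = ε s` gives `2 y y' = 2 ε w t = 2 ε w y z`; then cancel `2 y`. -/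
lemma θ_one_root : IDRing.θ 1 (root C ε)
    = ((ε : ℤ) : Expansion C ε) * algebraMap (CurveRing C) _ (w C) * coroot C ε := by
  have h := congrArg (IDRing.θ 1) (root_sq' C ε)
  rw [pow_two, IDRing.θ_one_apply_mul, IDRing.θ_one_apply_mul, θ_one_intCast, θ_one_algebraMap,
    deriv_s] at h
  simp only [map_mul, map_ofNat] at h
  apply mul_left_cancel₀ (mul_ne_zero two_ne_zero (root_ne_zero C ε))
  linear_combination h - 2 * ((ε : ℤ) : Expansion C ε) * algebraMap (CurveRing C) _ (w C)
    * root_mul_coroot C ε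

/-- Differentiating `y z = t` gives `y z' = 1 - ε w z² = 1 - w(s² - 1) = 2 w s²`, because `w(3s² -
1) = 1`. The right side is `y · 2 ε w s y`. -/
lemma θ_one_coroot : IDRing.θ 1 (coroot C ε)
    = 2 * ((ε : ℤ) : Expansion C ε) * algebraMap (CurveRing C) _ (w C)
      * algebraMap (CurveRing C) _ (s C) * root C ε := by
  have h := congrArg (IDRing.θ 1) (root_mul_coroot C ε)
  rw [IDRing.θ_one_apply_mul, θ_one_root, θ_one_algebraMap, deriv_t, map_one] at h
  apply mul_left_cancel₀ (root_ne_zero C ε)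
  set σ := algebraMap (CurveRing C) (Expansion C ε) (s C)
  set ω := algebraMap (CurveRing C) (Expansion C ε) (w C)
  linear_combination h - ((ε : ℤ) : Expansion C ε) * ω * coroot_sq C ε
    - 2 * ((ε : ℤ) : Expansion C ε) * ω * σ * root_sq' C ε - algebraMap_w_relation C ε
    - (ω * (σ ^ 2 - 1) + 2 * ω * σ ^ 2) * units_sq ε (Expansion C ε)

/-- The elements of `S[√(ε s), t/√(ε s)]` are the combinations of `1` and the two generators. -/
lemma mem_adjoin_iff {x : Expansion C ε} :
    x ∈ Algebra.adjoin (CurveRing C) {root C ε, coroot C ε} ↔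
      ∃ a b c : CurveRing C, x = algebraMap _ _ a + algebraMap _ _ b * root C ε
        + algebraMap _ _ c * coroot C ε := by
  constructor
  · intro hx
    induction hx using Algebra.adjoin_induction with
    | mem x hx =>
      rcases hx with rfl | rfl
      · exact ⟨0, 1, 0, by simp⟩
      · exact ⟨0, 0, 1, by simp⟩
    | algebraMap a => exact ⟨a, 0, 0, by simp⟩
    | add x y _ _ hx hy =>
      obtain ⟨a, b, c, rfl⟩ := hx
      obtain ⟨a', b', c', rfl⟩ := hy
      exact ⟨a + a', b + b', c + c', by simp only [map_add]; ring⟩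
    | mul x y _ _ hx hy =>
      obtain ⟨a, b, c, rfl⟩ := hx
      obtain ⟨a', b', c', rfl⟩ := hy
      refine ⟨a * a' + b * b' * (((ε : ℤ) : CurveRing C) * s C) + (b * c' + b' * c) * t C
        + c * c' * (((ε : ℤ) : CurveRing C) * (s C ^ 2 - 1)), a * b' + a' * b,
        a * c' + a' * c, ?_⟩
      simp only [map_add, map_mul, map_intCast, map_sub, map_pow, map_one]
      set ι := algebraMap (CurveRing C) (Expansion C ε)
      linear_combination ι b * ι b' * root_sq' C ε + (ι b * ι c' + ι b' * ι c) * root_mul_coroot C ε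
        + ι c * ι c' * coroot_sq C ε
  · rintro ⟨a, b, c, rfl⟩
    have h1 : root C ε ∈ Algebra.adjoin (CurveRing C) {root C ε, coroot C ε} :=
      Algebra.subset_adjoin (by simp)
    have h2 : coroot C ε ∈ Algebra.adjoin (CurveRing C) {root C ε, coroot C ε} :=
      Algebra.subset_adjoin (by simp)
    exact add_mem (add_mem (Subalgebra.algebraMap_mem _ a)
      (mul_mem (Subalgebra.algebraMap_mem _ b) h1)) (mul_mem (Subalgebra.algebraMap_mem _ c) h2)

/-- The ring `S[√(ε s), t/√(ε s)]` inside `C[[t]]`. -/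
def rootRing : IDSubalgebra (CurveRing C) (Expansion C ε) where
  toSubalgebra := Algebra.adjoin (CurveRing C) {root C ε, coroot C ε}
  θ_mem n := by
    refine IDRing.θ_mem_of_θ_one_mem C (Subalgebra.toSubmodule
      (Algebra.adjoin (CurveRing C) {root C ε, coroot C ε}) |>.restrictScalars C) ?_ n
    intro x hx
    change x ∈ Algebra.adjoin _ _ at hx
    change _ ∈ Algebra.adjoin _ _
    rw [mem_adjoin_iff] at hx ⊢
    obtain ⟨a, b, c, rfl⟩ := hx
    refine ⟨deriv C a, deriv C b + 2 * ((ε : ℤ) : CurveRing C) * w C * s C * c,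
      deriv C c + ((ε : ℤ) : CurveRing C) * w C * b, ?_⟩
    simp only [map_add, IDRing.θ_one_apply_mul, θ_one_algebraMap, θ_one_root, θ_one_coroot,
      map_mul, map_intCast, map_ofNat]
    ring

lemma mem_rootRing_iff {x : Expansion C ε} : x ∈ (rootRing C ε).toSubalgebra ↔
      ∃ a b c : CurveRing C, x = algebraMap _ _ a + algebraMap _ _ b * root C ε
        + algebraMap _ _ c * coroot C ε :=
  mem_adjoin_iff C ε

/-- The elements `1` and `√(ε s)` are linearly independent over `S`. -/
lemma add_mul_root_eq_zero {a b : CurveRing C}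
    (h : algebraMap _ (Expansion C ε) a + algebraMap _ _ b * root C ε = 0) : a = 0 ∧ b = 0 := by
  have hb : b = 0 := by
    apply CurveRing.eq_zero_of_sq_eq_mul_sq C ε (a := a)
    apply algebraMap_injective C ε
    simp only [map_pow, map_mul, map_intCast]
    linear_combination (algebraMap _ (Expansion C ε) a - algebraMap _ _ b * root C ε) * h
      + algebraMap _ (Expansion C ε) b ^ 2 * root_sq' C ε
  refine ⟨?_, hb⟩
  apply algebraMap_injective C ε
  rwa [hb, map_zero, zero_mul, add_zero, ← map_zero (algebraMap (CurveRing C) _)] at h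

/-- The sum `S + (S √(ε s) + S t/√(ε s))` is direct. -/
lemma eq_zero_of_eq_add {a b c : CurveRing C}
    (h : algebraMap _ (Expansion C ε) a + algebraMap _ _ b * root C ε
      + algebraMap _ _ c * coroot C ε = 0) : a = 0 := by
  -- Multiplication by `y` turns `a + b y + c z` into `(ε s b + t c) + a y`, and `1`, `y` are
  -- independent.
  refine (add_mul_root_eq_zero C ε (b := a) (a := b * (((ε : ℤ) : CurveRing C) * s C) + c * t C)
    ?_).2
  simp only [map_add, map_mul, map_intCast]
  linear_combination root C ε * h - algebraMap _ (Expansion C ε) b * root_sq' C ε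
    - algebraMap _ (Expansion C ε) c * root_mul_coroot C ε

end Expansion

/-! ### The Picard-Vessiot property -/

namespace Expansion

open CurveRing

variable (C : Type u) [Field C] [CharZero C] (ε : ℤˣ)

/-- The solution `f₁ ↦ √(ε s)`, `f₂ ↦ ε t/√(ε s)` of `M` in `C[[t]]`. -/
def solution (b : CurveRing C) : NonFreeModule b →ₗ[CurveRing C] Expansion C ε :=
  (moduleRelations C).liftQ
    ((LinearMap.toSpanSingleton (CurveRing C) (Expansion C ε) (root C ε)).comp
        (LinearMap.fst (CurveRing C) (CurveRing C) (CurveRing C))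
      + (LinearMap.toSpanSingleton (CurveRing C) (Expansion C ε)
        (((ε : ℤ) : Expansion C ε) * coroot C ε)).comp
        (LinearMap.snd (CurveRing C) (CurveRing C) (CurveRing C))) (by
    rw [moduleRelations, Submodule.span_le]
    rintro _ (rfl | rfl)
    · simp only [SetLike.mem_coe, LinearMap.mem_ker, LinearMap.add_apply, LinearMap.comp_apply,
        LinearMap.fst_apply, LinearMap.snd_apply, LinearMap.toSpanSingleton_apply,
        Algebra.smul_def, map_neg]
      linear_combination coroot C ε * root_sq' C ε - root C ε * root_mul_coroot C ε
    · simp only [SetLike.mem_coe, LinearMap.mem_ker, LinearMap.add_apply, LinearMap.comp_apply,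
        LinearMap.fst_apply, LinearMap.snd_apply, LinearMap.toSpanSingleton_apply,
        Algebra.smul_def, map_neg, map_sub, map_pow, map_one]
      linear_combination ((ε : ℤ) : Expansion C ε) * coroot C ε * root_mul_coroot C ε
        - ((ε : ℤ) : Expansion C ε) * root C ε * coroot_sq C ε
        - root C ε * (algebraMap (CurveRing C) (Expansion C ε) (s C) ^ 2 - 1)
          * units_sq ε (Expansion C ε))

lemma solution_mk (b : CurveRing C) (x : CurveRing C × CurveRing C) :
    solution C ε b (NonFreeModule.mk b x) = algebraMap _ _ x.1 * root C ε
      + algebraMap _ _ x.2 * (((ε : ℤ) : Expansion C ε) * coroot C ε) := by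
  refine (Submodule.liftQ_apply _ _ _).trans ?_
  simp [Algebra.smul_def]

/-- Horizontality is needed only for `θ 1`. The coefficient `b = -3stw` is the one for which `b y +
(3s² + 1) w ε z = ε w z = y'`, and likewise `s y + b ε z = 2 w s y = ε z'`. -/
lemma solution_θ (n : ℕ) (m : NonFreeModule (-3 * s C * t C * w C)) :
    solution C ε _ (IDModule.θ (CurveRing C) n m) = IDRing.θ n (solution C ε _ m) := by
  refine IDModule.map_θ_of_map_θ_one (S := CurveRing C) (solution C ε _).toAddMonoidHom ?_ n m
  intro m
  obtain ⟨x, rfl⟩ := NonFreeModule.mk_surjective _ m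
  have h1 : IDModule.θ (CurveRing C) 1 (NonFreeModule.mk (-3 * s C * t C * w C) x)
      = NonFreeModule.mk (-3 * s C * t C * w C)
        (NonFreeModule.preDeriv (-3 * s C * t C * w C) x) := by
    change dividedPow (NonFreeModule.derivM (-3 * s C * t C * w C)) 1
      (NonFreeModule.mk (-3 * s C * t C * w C) x) = _
    simp [dividedPow, NonFreeModule.derivM_mk]
  rw [h1]
  simp only [LinearMap.toAddMonoidHom_coe, solution_mk, map_add, IDRing.θ_one_apply_mul,
    θ_one_algebraMap, θ_one_root, θ_one_coroot, θ_one_intCast, NonFreeModule.preDeriv,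
    LinearMap.coe_mk, AddHom.coe_mk, map_mul, map_neg, map_ofNat, map_pow, map_one]
  have hw := algebraMap_w_relation C ε
  have hy := root_sq' C ε
  have hyz := root_mul_coroot C ε
  have hz := coroot_sq C ε
  have hε := units_sq ε (Expansion C ε)
  set e := ((ε : ℤ) : Expansion C ε)
  set y := root C ε
  set z := coroot C ε
  set σ := algebraMap (CurveRing C) (Expansion C ε) (s C)
  set τ := algebraMap (CurveRing C) (Expansion C ε) (t C)
  set ω := algebraMap (CurveRing C) (Expansion C ε) (w C)
  set a := algebraMap (CurveRing C) (Expansion C ε) x.1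
  set b := algebraMap (CurveRing C) (Expansion C ε) x.2
  -- These two relations absorb the factor `t` of `b`.
  have hty : τ * y = e * σ * z := by linear_combination - y * hyz + z * hy
  have htz : e * τ * z = y * (σ ^ 2 - 1) := by
    linear_combination - e * z * hyz + e * y * hz + y * (σ ^ 2 - 1) * hε
  linear_combination (-3 * σ * ω * a) * hty + (-3 * σ * ω * b) * htz - 2 * b * σ * ω * y * hε
    - b * σ * y * hw

/-- The square root of `ε s` as an element of `S[√(ε s), t/√(ε s)]`. -/
def rootElt : (rootRing C ε).toSubalgebra :=
  ⟨root C ε, (mem_rootRing_iff C ε).2 ⟨0, 1, 0, by simp⟩⟩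

/-- The element `t/√(ε s)` of `S[√(ε s), t/√(ε s)]`. -/
def corootElt : (rootRing C ε).toSubalgebra :=
  ⟨coroot C ε, (mem_rootRing_iff C ε).2 ⟨0, 0, 1, by simp⟩⟩

@[simp] lemma coe_rootElt : (rootElt C ε : Expansion C ε) = root C ε := rfl

@[simp] lemma coe_corootElt : (corootElt C ε : Expansion C ε) = coroot C ε := rfl

@[simp] lemma coe_rootRing_algebraMap (a : CurveRing C) :
    (algebraMap (CurveRing C) (rootRing C ε).toSubalgebra a : Expansion C ε)
      = algebraMap (CurveRing C) (Expansion C ε) a := rfl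

/-- The solution of `M` in `S[√(ε s), t/√(ε s)]`. -/
def rootRingSolution (b : CurveRing C) :
    NonFreeModule b →ₗ[CurveRing C] (rootRing C ε).toSubalgebra :=
  (solution C ε b).codRestrict (Subalgebra.toSubmodule (rootRing C ε).toSubalgebra) (fun m => by
    obtain ⟨x, rfl⟩ := NonFreeModule.mk_surjective b m
    rw [Subalgebra.mem_toSubmodule, mem_rootRing_iff, solution_mk]
    exact ⟨0, x.1, x.2 * ((ε : ℤ) : CurveRing C), by simp; ring⟩)

lemma coe_rootRingSolution (b : CurveRing C) (m : NonFreeModule b) :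
    (rootRingSolution C ε b m : Expansion C ε) = solution C ε b m := rfl

/-- The generator of `R ⊗ M` is `e = ε s y ⊗ f₁ - z ⊗ f₂`. Its pairing is `ε s y² - ε z² = s² - (s²
- 1) = 1`. The relations of `M` show that `1 ⊗ f₁` and `1 ⊗ f₂` are the multiples `y e` and `ε z e`.
-/
lemma isSolutionRing_rootRing : IsSolutionRing (CurveRing C)
    (NonFreeModule (-3 * s C * t C * w C)) (rootRing C ε).toSubalgebra := by
  set b := -3 * s C * t C * w C
  have hf₁ : (rootRingSolution C ε b (NonFreeModule.f₁ b) : Expansion C ε) = root C ε := by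
    rw [coe_rootRingSolution, NonFreeModule.f₁, solution_mk]; simp
  have hf₂ : (rootRingSolution C ε b (NonFreeModule.f₂ b) : Expansion C ε)
      = ((ε : ℤ) : Expansion C ε) * coroot C ε := by
    rw [coe_rootRingSolution, NonFreeModule.f₂, solution_mk]; simp
  have hy := root_sq' C ε
  have hyz := root_mul_coroot C ε
  have hz := coroot_sq C ε
  have hε := units_sq ε (Expansion C ε)
  set e : (rootRing C ε).toSubalgebra ⊗[CurveRing C] NonFreeModule b :=
    (algebraMap (CurveRing C) _ (((ε : ℤ) : CurveRing C) * s C) * rootElt C ε) ⊗ₜ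
      NonFreeModule.f₁ b - corootElt C ε ⊗ₜ NonFreeModule.f₂ b with he
  have hr₁ : t C • NonFreeModule.f₁ b = s C • NonFreeModule.f₂ b := by
    rw [← sub_eq_zero, NonFreeModule.f₁, NonFreeModule.f₂, ← map_smul, ← map_smul, ← map_sub]
    refine (Submodule.Quotient.mk_eq_zero _).2 (Submodule.subset_span ?_)
    simp
  have hr₂ : (s C ^ 2 - 1) • NonFreeModule.f₁ b = t C • NonFreeModule.f₂ b := by
    rw [← sub_eq_zero, NonFreeModule.f₁, NonFreeModule.f₂, ← map_smul, ← map_smul, ← map_sub]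
    refine (Submodule.Quotient.mk_eq_zero _).2 (Submodule.subset_span ?_)
    simp
  refine isSolutionRing_of_horizontal (rootRingSolution C ε b)
    (fun n m => Subtype.ext (solution_θ C ε n m)) e ?_ ?_
  · rw [he, map_sub, tensorPairing_tmul, tensorPairing_tmul]
    apply Subtype.ext
    simp only [AlgHom.coe_id, id_eq, AddSubgroupClass.coe_sub, MulMemClass.coe_mul, hf₁, hf₂,
      coe_rootElt, coe_corootElt, coe_rootRing_algebraMap, OneMemClass.coe_one, map_mul,
      map_intCast]
    set σ := algebraMap (CurveRing C) (Expansion C ε) (s C)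
    linear_combination ((ε : ℤ) : Expansion C ε) * σ * hy - ((ε : ℤ) : Expansion C ε) * hz
      + hε
  · have h₁ : (1 : (rootRing C ε).toSubalgebra) ⊗ₜ[CurveRing C] NonFreeModule.f₁ b
        = rootRingSolution C ε b (NonFreeModule.f₁ b) • e := by
      have e1 : rootRingSolution C ε b (NonFreeModule.f₁ b)
          * (algebraMap (CurveRing C) _ (((ε : ℤ) : CurveRing C) * s C) * rootElt C ε)
          = algebraMap (CurveRing C) _ (s C ^ 2) := Subtype.ext (by
        simp only [MulMemClass.coe_mul, hf₁, coe_rootElt, coe_rootRing_algebraMap]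
        simp only [map_mul, map_intCast, map_pow]
        set σ := algebraMap (CurveRing C) (Expansion C ε) (s C)
        linear_combination ((ε : ℤ) : Expansion C ε) * σ * hy + σ ^ 2 * hε)
      have e2 : rootRingSolution C ε b (NonFreeModule.f₁ b) * corootElt C ε
          = algebraMap (CurveRing C) _ (t C) := Subtype.ext (by
        simp only [MulMemClass.coe_mul, hf₁, coe_corootElt, coe_rootRing_algebraMap]
        exact hyz)
      rw [he, smul_sub, TensorProduct.smul_tmul', TensorProduct.smul_tmul', smul_eq_mul,
        smul_eq_mul, e1, e2, Algebra.algebraMap_eq_smul_one, Algebra.algebraMap_eq_smul_one,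
        TensorProduct.smul_tmul, TensorProduct.smul_tmul, ← hr₂, ← TensorProduct.tmul_sub,
        ← sub_smul]
      congr 1
      simp
    have h₂ : (1 : (rootRing C ε).toSubalgebra) ⊗ₜ[CurveRing C] NonFreeModule.f₂ b
        = rootRingSolution C ε b (NonFreeModule.f₂ b) • e := by
      have e1 : rootRingSolution C ε b (NonFreeModule.f₂ b)
          * (algebraMap (CurveRing C) _ (((ε : ℤ) : CurveRing C) * s C) * rootElt C ε)
          = algebraMap (CurveRing C) _ (s C * t C) := Subtype.ext (by
        simp only [MulMemClass.coe_mul, hf₂, coe_rootElt, coe_rootRing_algebraMap, map_mul,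
          map_intCast]
        set σ := algebraMap (CurveRing C) (Expansion C ε) (s C)
        linear_combination ((ε : ℤ) : Expansion C ε) ^ 2 * σ * hyz
          + σ * algebraMap (CurveRing C) (Expansion C ε) (t C) * hε)
      have e2 : rootRingSolution C ε b (NonFreeModule.f₂ b) * corootElt C ε
          = algebraMap (CurveRing C) _ (s C ^ 2 - 1) := Subtype.ext (by
        simp only [MulMemClass.coe_mul, hf₂, coe_corootElt, coe_rootRing_algebraMap]
        simp only [map_sub, map_pow, map_one]
        set σ := algebraMap (CurveRing C) (Expansion C ε) (s C)
        linear_combination ((ε : ℤ) : Expansion C ε) * hz + (σ ^ 2 - 1) * hε)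
      rw [he, smul_sub, TensorProduct.smul_tmul', TensorProduct.smul_tmul', smul_eq_mul,
        smul_eq_mul, e1, e2, Algebra.algebraMap_eq_smul_one, Algebra.algebraMap_eq_smul_one,
        TensorProduct.smul_tmul, TensorProduct.smul_tmul, mul_smul, hr₁, smul_smul,
        ← TensorProduct.tmul_sub, ← sub_smul]
      congr 1
      rw [← pow_two, sub_sub_cancel, one_smul]
    intro m
    obtain ⟨x, rfl⟩ := NonFreeModule.mk_surjective b m
    have hx : NonFreeModule.mk b x = x.1 • NonFreeModule.f₁ b + x.2 • NonFreeModule.f₂ b := by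
      rw [NonFreeModule.f₁, NonFreeModule.f₂, ← map_smul, ← map_smul, ← map_add]
      congr 1
      ext <;> simp
    rw [hx, TensorProduct.tmul_add, TensorProduct.tmul_smul, TensorProduct.tmul_smul, h₁, h₂,
      map_add, map_smul, map_smul, add_smul, smul_assoc, smul_assoc]

/-- `C[[t]]` and its sub-ID-algebras have constants `C`. -/
lemma constants_subalgebra (R : IDSubalgebra (CurveRing C) (Expansion C ε)) :
    IDRing.constants R.toSubalgebra
      = (IDRing.constants (CurveRing C)).map (algebraMap (CurveRing C) R.toSubalgebra) := by
  ext x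
  rw [CurveRing.constants_eq]
  constructor
  · intro hx
    refine ⟨algebraMap C _ (constCoeff (x : Expansion C ε)), ⟨_, rfl⟩, Subtype.ext ?_⟩
    refine Eq.trans ?_ (eq_algebraMap_of_θ_one_eq_zero C ε (x := x)
      (congrArg Subtype.val (hx 1 one_pos))).symm
    exact (IsScalarTower.algebraMap_apply C (CurveRing C) (Expansion C ε) _).symm
  · rintro ⟨_, ⟨c, rfl⟩, rfl⟩ n hn
    rw [IDAlgebra.θ_algebraMap, IDConstAlgebra.θ_algebraMap_eq_zero n hn c, map_zero]

/-- The image of a solution ring for `M` in `C[[t]]` contains `S[√(ε s), t/√(ε s)]`. -/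
lemma rootRing_le_range {R' : Type*} [CommRing R'] [IDRing R'] [Algebra (CurveRing C) R']
    [IDAlgebra (CurveRing C) R']
    (h : IsSolutionRing (CurveRing C) (NonFreeModule (-3 * s C * t C * w C)) R')
    (g : R' →ₐ[CurveRing C] Expansion C ε) (hg : ∀ n x, g (IDRing.θ n x) = IDRing.θ n (g x)) :
    (rootRing C ε).toSubalgebra ≤ g.range := by
  have key := h.horizontal_mem_range g hg (fun c hc => by
    rw [eq_algebraMap_of_θ_one_eq_zero C ε (hc 1 one_pos),
      IsScalarTower.algebraMap_apply C (CurveRing C)]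
    exact g.range.algebraMap_mem _) (solution C ε _) (solution_θ C ε)
  refine Algebra.adjoin_le ?_
  rintro _ (rfl | rfl)
  · simpa [solution_mk] using key (NonFreeModule.mk _ (1, 0))
  -- The vector `ε f₂` is sent to `ε² z = z`.
  · have := key (NonFreeModule.mk _ (0, ((ε : ℤ) : CurveRing C)))
    rwa [solution_mk, map_zero, zero_mul, zero_add, map_intCast, ← mul_assoc, ← pow_two, units_sq,
      one_mul] at this

end Expansion

/-! ### ID-simplicity, minimality, uniqueness and rank -/

namespace Expansion

open CurveRing

variable (C : Type u) [Field C] [CharZero C] (ε : ℤˣ)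

/-- Every element of a ring `S[√(ε s), t/√(ε s)]` other than `0` divides a non-zero polynomial
in `t`. -/
lemma exists_mul_eq_aeval {x : (rootRing C ε).toSubalgebra} (hx : x ≠ 0) :
    ∃ (r : (rootRing C ε).toSubalgebra) (p : Polynomial C), p ≠ 0 ∧
      x * r = algebraMap (CurveRing C) _ (Polynomial.aeval (t C) p) := by
  let R := (rootRing C ε).toSubalgebra
  let f : Polynomial C →+* R := (algebraMap (CurveRing C) R).comp
    (Polynomial.aeval (t C) : Polynomial C →ₐ[C] CurveRing C).toRingHom
  let _ : Algebra (Polynomial C) R := f.toAlgebra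
  have hf : ∀ p, ((f p : R) : Expansion C ε)
      = Polynomial.aeval (algebraMap (CurveRing C) (Expansion C ε) (t C)) p := fun p =>
    (Polynomial.aeval_algebraMap_apply (Expansion C ε) (t C) p).symm
  have hfi : Function.Injective (algebraMap (Polynomial C) R) := fun p q h => by
    apply aeval_algebraMap_t_injective C ε
    rw [← hf, ← hf]
    exact congrArg Subtype.val h
  have hbase : ∀ p : Polynomial C, IsAlgebraic (Polynomial C)
      (algebraMap (CurveRing C) R (Polynomial.aeval (t C) p)) := fun p =>
    isAlgebraic_algebraMap (A := R) p
  have hs : IsAlgebraic (Polynomial C) (algebraMap (CurveRing C) R (s C)) := by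
    refine ⟨curveCubic C, curveCubic_monic.ne_zero, ?_⟩
    have hX : algebraMap (Polynomial C) R Polynomial.X = algebraMap (CurveRing C) R (t C) :=
      congrArg (algebraMap (CurveRing C) R) (Polynomial.aeval_X (t C))
    simp only [curveCubic, map_sub, map_pow, Polynomial.aeval_X, Polynomial.aeval_C, hX]
    rw [← map_pow, ← map_pow, ← map_sub, ← map_sub, s_t_relation, map_zero]
  have hS : ∀ a : CurveRing C, IsAlgebraic (Polynomial C) (algebraMap (CurveRing C) R a) := by
    intro a
    induction a using CurveRing.induction_on with
    | hC c => simpa using hbase (Polynomial.C c)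
    | hs => exact hs
    | ht => simpa using hbase Polynomial.X
    | hw =>
      have h1 : IsAlgebraic (Polynomial C) (algebraMap (CurveRing C) R (3 * s C ^ 2 - 1)) := by
        rw [map_sub, map_mul, map_pow, map_ofNat, map_one]
        have h3 : IsAlgebraic (Polynomial C) (3 : R) := by
          rw [← map_ofNat (algebraMap (Polynomial C) R) 3]
          exact isAlgebraic_algebraMap _
        exact (h3.mul (hs.pow 2)).sub isAlgebraic_one
      have h2 : algebraMap (CurveRing C) R (w C)
          * algebraMap (CurveRing C) R (3 * s C ^ 2 - 1) = 1 := by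
        rw [← map_mul, w_relation, map_one]
      let _ : Invertible (algebraMap (CurveRing C) R (3 * s C ^ 2 - 1)) :=
        ⟨algebraMap (CurveRing C) R (w C), h2, by rw [mul_comm]; exact h2⟩
      exact h1.invOf
    | hadd a b ha hb => rw [map_add]; exact ha.add hb
    | hmul a b ha hb => rw [map_mul]; exact ha.mul hb
  have hy : IsAlgebraic (Polynomial C) (rootElt C ε) := by
    refine IsAlgebraic.of_pow two_pos ?_
    have : rootElt C ε ^ 2 = algebraMap (CurveRing C) R (((ε : ℤ) : CurveRing C) * s C) :=
      Subtype.ext (root_sq C ε)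
    rw [this]
    exact hS _
  have hz : IsAlgebraic (Polynomial C) (corootElt C ε) := by
    refine IsAlgebraic.of_pow two_pos ?_
    have : corootElt C ε ^ 2
        = algebraMap (CurveRing C) R (((ε : ℤ) : CurveRing C) * (s C ^ 2 - 1)) := by
      refine Subtype.ext ((coroot_sq C ε).trans ?_)
      simp
    rw [this]
    exact hS _
  have hxa : IsAlgebraic (Polynomial C) x := by
    obtain ⟨a, b, c, h⟩ := (mem_rootRing_iff C ε).1 x.2
    have : x = algebraMap (CurveRing C) R a + algebraMap (CurveRing C) R b * rootElt C ε
        + algebraMap (CurveRing C) R c * corootElt C ε := Subtype.ext h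
    rw [this]
    exact ((hS a).add ((hS b).mul hy)).add ((hS c).mul hz)
  -- An algebraic non-zero-divisor divides the constant term of a relation freed from powers of the
  -- variable.
  obtain ⟨p, hp, r, hr⟩ := hxa.exists_nonzero_dvd (mem_nonZeroDivisors_of_ne_zero hx)
  exact ⟨r, p, hp, hr.symm⟩

/-- For `n = deg p`, the coefficient of `θ n p` at `t^k` is a multiple of the coefficient of `p` at
`t^(k + n)`, which vanishes for `k > 0`. -/
lemma θ_natDegree_aeval_t (p : Polynomial C) :
    IDRing.θ p.natDegree (Polynomial.aeval (t C) p) = algebraMap C (CurveRing C) p.leadingCoeff := by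
  apply algebraMap_injective C 1
  rw [← IDAlgebra.θ_algebraMap, ← Polynomial.aeval_algebraMap_apply, aeval_algebraMap_t,
    ← IsScalarTower.algebraMap_apply]
  refine PowerSeries.ext (R := C) fun k => ?_
  refine (PowerSeries.coeff_θ C _ _ _).trans ?_
  refine Eq.trans ?_ (PowerSeries.coeff_C k p.leadingCoeff).symm
  rw [Polynomial.coeff_coe]
  split_ifs with h
  · simp [h]
  · rw [Polynomial.coeff_eq_zero_of_natDegree_lt (by omega), mul_zero]

lemma idSimple_rootRing : IDSimple (rootRing C ε).toSubalgebra := by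
  refine ⟨inferInstance, fun I hI => ?_⟩
  rw [or_iff_not_imp_left]
  intro hI0
  obtain ⟨x, hxI, hx⟩ := Submodule.exists_mem_ne_zero_of_ne_bot hI0
  obtain ⟨r, p, hp, h⟩ := exists_mul_eq_aeval C ε hx
  have h1 := hI p.natDegree _ (I.mul_mem_right r hxI)
  rw [h, IDAlgebra.θ_algebraMap, θ_natDegree_aeval_t C] at h1
  refine Ideal.eq_top_of_isUnit_mem _ h1 ?_
  exact ((isUnit_iff_ne_zero.2 (Polynomial.leadingCoeff_ne_zero.2 hp)).map
    (algebraMap C (CurveRing C))).map (algebraMap (CurveRing C) _)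

/-- Minimality: a solution ring embedded in `R` is also mapped to `C[[t]]`, and there its image must
contain `y` and `z`, hence `R`. -/
lemma isPicardVessiotRing_rootRing : IsPicardVessiotRing (CurveRing C)
    (NonFreeModule (-3 * s C * t C * w C)) (rootRing C ε).toSubalgebra where
  isSolutionRing := isSolutionRing_rootRing C ε
  idSimple := idSimple_rootRing C ε
  constants_eq := constants_subalgebra C ε (rootRing C ε)
  minimal R' _ _ _ _ h g hg hinj := by
    refine ⟨hinj, fun x => ?_⟩
    obtain ⟨r, hr⟩ := rootRing_le_range C ε h ((rootRing C ε).toSubalgebra.val.comp g)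
      (fun n r => congrArg Subtype.val (hg n r)) x.2
    exact ⟨r, Subtype.ext hr⟩

/-- The ring `S[√(ε s), t/√(ε s)]` is the only Picard-Vessiot ring for `M` inside `C[[t]]`. -/
lemma isPicardVessiotRing_iff (R' : IDSubalgebra (CurveRing C) (Expansion C ε)) :
    IsPicardVessiotRing (CurveRing C) (NonFreeModule (-3 * s C * t C * w C)) R'.toSubalgebra
      ↔ R' = rootRing C ε := by
  constructor
  · intro h
    have hle : (rootRing C ε).toSubalgebra ≤ R'.toSubalgebra := by
      have := rootRing_le_range C ε h.isSolutionRing R'.toSubalgebra.val (fun _ _ => rfl)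
      rwa [Subalgebra.range_val] at this
    -- The minimality of `R'` is applied to the inclusion of the solution ring generated by `y` and
    -- `z`.
    have hsurj := (h.minimal _ (isSolutionRing_rootRing C ε) (Subalgebra.inclusion hle)
      (fun _ _ => rfl) (Subalgebra.inclusion_injective hle)).2
    have heq : R'.toSubalgebra = (rootRing C ε).toSubalgebra := by
      refine le_antisymm (fun x hx => ?_) hle
      obtain ⟨r, hr⟩ := hsurj ⟨x, hx⟩
      have hrx : (r : Expansion C ε) = x := congrArg Subtype.val hr
      exact hrx ▸ r.2
    obtain ⟨A, _⟩ := R'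
    change A = _ at heq
    subst heq
    rfl
  · rintro rfl
    exact isPicardVessiotRing_rootRing C ε

/-! ### The degree -/

lemma finite_rootRing : Module.Finite (CurveRing C) (rootRing C ε).toSubalgebra := by
  classical
  refine ⟨⟨{1, rootElt C ε, corootElt C ε}, ?_⟩⟩
  rw [eq_top_iff]
  rintro x -
  obtain ⟨a, b, c, h⟩ := (mem_rootRing_iff C ε).1 x.2
  have hx : x = a • (1 : (rootRing C ε).toSubalgebra) + b • rootElt C ε + c • corootElt C ε := by
    refine Subtype.ext (h.trans ?_)
    simp [Algebra.smul_def]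
  rw [hx]
  refine add_mem (add_mem ?_ ?_) ?_ <;>
    exact Submodule.smul_mem _ _ (Submodule.subset_span (by simp))

/-- Since `s z = ε t y`, multiplication by `s` embeds `R` into the free module `S ⊕ S y`, which in
turn lies in `R`. So the rank is `2` although `y`, `z` satisfy a relation. -/
lemma finrank_rootRing : Module.finrank (CurveRing C) (rootRing C ε).toSubalgebra = 2 := by
  have := finite_rootRing C ε
  let f : (Fin 2 → CurveRing C) →ₗ[CurveRing C] (rootRing C ε).toSubalgebra :=
    Fintype.linearCombination (CurveRing C) ![1, rootElt C ε]
  have hf : ∀ v, (f v : Expansion C ε)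
      = algebraMap _ _ (v 0) + algebraMap _ _ (v 1) * root C ε := fun v => by
    simp [f, Fintype.linearCombination_apply, Fin.sum_univ_two, Algebra.smul_def]
  have hfi : Function.Injective f := by
    rw [injective_iff_map_eq_zero]
    intro v hv
    have h0 := congrArg Subtype.val hv
    rw [hf] at h0
    obtain ⟨h1, h2⟩ := add_mul_root_eq_zero C ε h0
    ext i
    match i with
    | 0 => exact h1
    | 1 => exact h2
  have hrange : ∀ x : (rootRing C ε).toSubalgebra, s C • x ∈ LinearMap.range f := by
    intro x
    obtain ⟨a, b, c, h⟩ := (mem_rootRing_iff C ε).1 x.2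
    refine ⟨![s C * a, s C * b + ((ε : ℤ) : CurveRing C) * t C * c], Subtype.ext ?_⟩
    rw [hf]
    change _ = s C • (x : Expansion C ε)
    rw [h]
    simp only [Matrix.cons_val_zero, Matrix.cons_val_one, Algebra.smul_def, map_mul, map_add,
      map_intCast]
    linear_combination - ((ε : ℤ) : Expansion C ε) * algebraMap _ (Expansion C ε) c
      * (root C ε * root_mul_coroot C ε - coroot C ε * root_sq' C ε) +
      algebraMap _ (Expansion C ε) c * algebraMap _ (Expansion C ε) (s C) * coroot C ε
        * units_sq ε (Expansion C ε)
  apply le_antisymm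
  · let g : (rootRing C ε).toSubalgebra →ₗ[CurveRing C] LinearMap.range f :=
      (LinearMap.lsmul (CurveRing C) (rootRing C ε).toSubalgebra (s C)).codRestrict _ hrange
    have hgi : Function.Injective g := by
      rw [injective_iff_map_eq_zero]
      intro x hx
      have h0 : s C • (x : Expansion C ε) = 0 :=
        congrArg Subtype.val (congrArg Subtype.val hx)
      rw [Algebra.smul_def] at h0
      refine Subtype.ext ((mul_eq_zero.1 h0).resolve_left ?_)
      exact (map_ne_zero_iff _ (algebraMap_injective C ε)).2 (s_ne_zero C)
    refine (LinearMap.finrank_le_finrank_of_injective hgi).trans ?_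
    rw [LinearMap.finrank_range_of_inj hfi, Module.finrank_fin_fun]
  · have := LinearMap.finrank_le_finrank_of_injective hfi
    rwa [Module.finrank_fin_fun] at this

end Expansion

/-! ### The Galois group -/

section BaseChange

variable {C R D : Type*} [CommRing C] [CommRing R] [IDRing R] [Algebra C R] [IDConstAlgebra C R]
  [CommRing D] [Algebra C D]

@[simp]
lemma baseθ_tmul (n : ℕ) (r : R) (d : D) :
    baseθ C R D n (r ⊗ₜ[C] d) = IDRing.θ n r ⊗ₜ[C] d := rfl

lemma baseθ_one_mul (x y : R ⊗[C] D) :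
    baseθ C R D 1 (x * y) = x * baseθ C R D 1 y + baseθ C R D 1 x * y := by
  induction x using TensorProduct.induction_on with
  | zero => simp
  | add x x' hx hx' => simp only [add_mul, map_add, hx, hx']; ring
  | tmul r d =>
    induction y using TensorProduct.induction_on with
    | zero => simp
    | add y y' hy hy' => simp only [mul_add, map_add, hy, hy']; ring
    | tmul r' d' =>
      simp [IDRing.θ_one_apply_mul, TensorProduct.add_tmul]

/-- If the kernel of `θ 1` on `R` is `C`, its kernel on `R ⊗ D` is `D`, for flat `D`. -/
lemma exists_eq_one_tmul_of_baseθ_one_eq_zero [Module.Flat C D]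
    (h : ∀ r : R, IDRing.θ 1 r = 0 → r ∈ (algebraMap C R).range) {x : R ⊗[C] D}
    (hx : baseθ C R D 1 x = 0) : ∃ d : D, x = 1 ⊗ₜ d := by
  -- The kernel statement is the exactness of `C → R → R`, which flatness of `D` preserves.
  have hexact : Function.Exact (Algebra.linearMap C R) (IDRing.θLin C R 1) := by
    intro r
    constructor
    · intro hr
      obtain ⟨c, hc⟩ := h r hr
      exact ⟨c, hc⟩
    · rintro ⟨c, rfl⟩
      exact IDConstAlgebra.θ_algebraMap_eq_zero 1 one_pos c
  obtain ⟨z, rfl⟩ := (Module.Flat.rTensor_exact D hexact x).1 hx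
  induction z using TensorProduct.induction_on with
  | zero => exact ⟨0, by simp⟩
  | add a b ha hb =>
    -- Each summand comes from `C ⊗ D`, so it lies in the kernel and the induction hypothesis
    -- applies to it.
    obtain ⟨d, hd⟩ := ha (by
      exact (Module.Flat.rTensor_exact D hexact _).2 ⟨a, rfl⟩)
    obtain ⟨d', hd'⟩ := hb (by
      exact (Module.Flat.rTensor_exact D hexact _).2 ⟨b, rfl⟩)
    exact ⟨d + d', by rw [map_add, hd, hd', TensorProduct.tmul_add]⟩
  | tmul c d =>
    refine ⟨c • d, ?_⟩
    rw [LinearMap.rTensor_tmul, Algebra.linearMap_apply, Algebra.algebraMap_eq_smul_one,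
      TensorProduct.smul_tmul]

end BaseChange

/-! ### The `ℤ/2`-grading of `R` and the shape of ID-automorphisms -/

namespace Expansion

open CurveRing

variable (C : Type u) [Field C] [CharZero C] (ε : ℤˣ)

/-- The ring `S[√(ε s), t/√(ε s)]` as a type. -/
abbrev RootRing : Type u := (rootRing C ε).toSubalgebra

lemma exists_rootRing_eq (x : RootRing C ε) : ∃ a b c : CurveRing C,
    x = algebraMap _ _ a + algebraMap _ _ b * rootElt C ε + algebraMap _ _ c * corootElt C ε := by
  obtain ⟨a, b, c, h⟩ := (mem_rootRing_iff C ε).1 x.2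
  exact ⟨a, b, c, Subtype.ext h⟩

lemma rootElt_sq : rootElt C ε ^ 2
    = algebraMap (CurveRing C) (RootRing C ε) (((ε : ℤ) : CurveRing C) * s C) :=
  Subtype.ext (root_sq C ε)

lemma rootElt_mul_corootElt :
    rootElt C ε * corootElt C ε = algebraMap (CurveRing C) (RootRing C ε) (t C) :=
  Subtype.ext (root_mul_coroot C ε)

lemma corootElt_sq : corootElt C ε ^ 2
    = algebraMap (CurveRing C) (RootRing C ε) (((ε : ℤ) : CurveRing C) * (s C ^ 2 - 1)) :=
  Subtype.ext ((coroot_sq C ε).trans (by simp))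

lemma θ_one_rootElt : IDRing.θ 1 (rootElt C ε)
    = algebraMap (CurveRing C) (RootRing C ε) (((ε : ℤ) : CurveRing C) * w C)
      * corootElt C ε :=
  Subtype.ext ((θ_one_root C ε).trans (by simp))

lemma θ_one_corootElt : IDRing.θ 1 (corootElt C ε)
    = algebraMap (CurveRing C) (RootRing C ε) (2 * ((ε : ℤ) : CurveRing C) * w C * s C)
      * rootElt C ε :=
  Subtype.ext ((θ_one_coroot C ε).trans (by
    rw [MulMemClass.coe_mul, coe_rootRing_algebraMap, coe_rootElt]
    simp only [map_mul, map_ofNat, map_intCast]))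

lemma θ_one_rootRing_algebraMap (a : CurveRing C) :
    IDRing.θ 1 (algebraMap (CurveRing C) (RootRing C ε) a) = algebraMap _ _ (deriv C a) := by
  rw [IDAlgebra.θ_algebraMap, θ_one_eq_deriv]

/-- The coefficient of `1` of an element of `S[√(ε s), t/√(ε s)]`. -/
def evenCoeff (x : RootRing C ε) : CurveRing C := (exists_rootRing_eq C ε x).choose

/-- In `a + b y + c z` the pair `(b, c)` is not unique, because `t y = ε s z`, but `a` is. So the
choice in `evenCoeff` is harmless. -/
lemma evenCoeff_eq (a b c : CurveRing C) :
    evenCoeff C ε (algebraMap _ _ a + algebraMap _ _ b * rootElt C ε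
      + algebraMap _ _ c * corootElt C ε) = a := by
  set x : RootRing C ε := algebraMap _ _ a + algebraMap _ _ b * rootElt C ε
      + algebraMap _ _ c * corootElt C ε with hx
  obtain ⟨b', c', h⟩ := (exists_rootRing_eq C ε x).choose_spec
  change x = algebraMap _ _ (evenCoeff C ε x) + _ + _ at h
  rw [← sub_eq_zero]
  refine eq_zero_of_eq_add C ε (b := b' - b) (c := c' - c) ?_
  have h2 := congrArg Subtype.val (h.symm.trans hx)
  simp only [AddMemClass.coe_add, MulMemClass.coe_mul, coe_rootRing_algebraMap, coe_rootElt,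
    coe_corootElt] at h2
  simp only [map_sub]
  linear_combination h2

/-- The projection of `S[√(ε s), t/√(ε s)]` to its summand `S`. -/
def evenPart : RootRing C ε →ₗ[CurveRing C] RootRing C ε where
  toFun x := algebraMap _ _ (evenCoeff C ε x)
  map_add' x x' := by
    obtain ⟨a, b, c, rfl⟩ := exists_rootRing_eq C ε x
    obtain ⟨a', b', c', rfl⟩ := exists_rootRing_eq C ε x'
    rw [evenCoeff_eq, evenCoeff_eq, ← map_add, ← evenCoeff_eq C ε (a + a') (b + b') (c + c')]
    congr 2
    simp only [map_add]
    ring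
  map_smul' r x := by
    obtain ⟨a, b, c, rfl⟩ := exists_rootRing_eq C ε x
    rw [evenCoeff_eq, RingHom.id_apply, Algebra.smul_def, Algebra.smul_def, ← map_mul,
      ← evenCoeff_eq C ε (r * a) (r * b) (r * c)]
    congr 2
    simp only [map_mul]
    ring

lemma evenPart_eq (a b c : CurveRing C) :
    evenPart C ε (algebraMap _ _ a + algebraMap _ _ b * rootElt C ε
      + algebraMap _ _ c * corootElt C ε) = algebraMap _ _ a :=
  congrArg (algebraMap _ _) (evenCoeff_eq C ε a b c)

lemma evenPart_algebraMap (a : CurveRing C) :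
    evenPart C ε (algebraMap _ _ a) = algebraMap _ _ a := by
  simpa using evenPart_eq C ε a 0 0

lemma evenPart_rootElt : evenPart C ε (rootElt C ε) = 0 := by
  simpa using evenPart_eq C ε 0 1 0

lemma evenPart_evenPart (x : RootRing C ε) : evenPart C ε (evenPart C ε x) = evenPart C ε x :=
  evenPart_algebraMap C ε _

/-- The products `y²`, `y z`, `z²` all lie in `S`, so odd times odd is even. -/
lemma evenPart_mul (x x' : RootRing C ε) : evenPart C ε (x * x')
    = evenPart C ε x * evenPart C ε x' + (x - evenPart C ε x) * (x' - evenPart C ε x') := by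
  obtain ⟨a, b, c, rfl⟩ := exists_rootRing_eq C ε x
  obtain ⟨a', b', c', rfl⟩ := exists_rootRing_eq C ε x'
  rw [evenPart_eq, evenPart_eq]
  have h := evenPart_eq C ε
    (a * a' + b * b' * (((ε : ℤ) : CurveRing C) * s C) + (b * c' + b' * c) * t C
        + c * c' * (((ε : ℤ) : CurveRing C) * (s C ^ 2 - 1))) (a * b' + a' * b) (a * c' + a' * c)
  have hy := rootElt_sq C ε
  have hyz := rootElt_mul_corootElt C ε
  have hz := corootElt_sq C ε
  refine (congrArg (evenPart C ε) ?_).trans (h.trans ?_)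
  · simp only [map_add, map_mul _ (_ * _) (_ * _), map_mul _ (_ + _) _, ← hy, ← hyz, ← hz]
    simp only [map_mul]
    ring
  · simp only [map_add, map_mul _ (_ * _) (_ * _), map_mul _ (_ + _) _, ← hy, ← hyz, ← hz]
    simp only [map_mul]
    ring

instance : CharZero (RootRing C ε) :=
  charZero_of_injective_algebraMap (algebraMap C (RootRing C ε)).injective

lemma evenPart_θ (n : ℕ) (x : RootRing C ε) :
    evenPart C ε (IDRing.θ n x) = IDRing.θ n (evenPart C ε x) := by
  refine IDRing.map_θ_of_map_θ_one (evenPart C ε).toAddMonoidHom ?_ n x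
  intro x
  obtain ⟨a, b, c, rfl⟩ := exists_rootRing_eq C ε x
  simp only [LinearMap.toAddMonoidHom_coe, evenPart_eq, θ_one_rootRing_algebraMap]
  rw [← evenPart_eq C ε (deriv C a) (deriv C b + 2 * ((ε : ℤ) : CurveRing C) * w C * s C * c)
    (deriv C c + ((ε : ℤ) : CurveRing C) * w C * b)]
  congr 1
  simp only [map_add, IDRing.θ_one_apply_mul, θ_one_rootRing_algebraMap, θ_one_rootElt,
    θ_one_corootElt, map_mul]
  ring

/-- The value at `t = 0` of an element of `S[√(ε s), t/√(ε s)]`. -/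
def rootRingEval : RootRing C ε →ₐ[C] C where
  __ := constCoeff.comp (rootRing C ε).toSubalgebra.val.toRingHom
  commutes' c := constCoeff_algebraMap_base C ε c

lemma rootRingEval_apply (x : RootRing C ε) :
    rootRingEval C ε x = constCoeff (x : Expansion C ε) := rfl

variable (D : Type*) [CommRing D] [Algebra C D]

/-- The value at `t = 0` of an element of `R ⊗ D`. -/
def baseEval : RootRing C ε ⊗[C] D →ₐ[C] D :=
  Algebra.TensorProduct.lift ((Algebra.ofId C D).comp (rootRingEval C ε)) (AlgHom.id C D)
    (fun _ _ => mul_comm _ _)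

lemma baseEval_rootElt_tmul (d : D) : baseEval C ε D (rootElt C ε ⊗ₜ d) = d := by
  refine (Algebra.TensorProduct.lift_tmul _ _ _ _ _).trans ?_
  simp [rootRingEval_apply, constCoeff_root]

lemma baseEval_one_tmul (d : D) : baseEval C ε D (1 ⊗ₜ d) = d := by
  refine (Algebra.TensorProduct.lift_tmul _ _ _ _ _).trans ?_
  simp

variable {C ε D}

lemma idGal_fix_algebraMap
    {σ : (RootRing C ε ⊗[C] D) ≃ₐ[C] (RootRing C ε ⊗[C] D)}
    (hσ : σ ∈ idGal C (CurveRing C) (RootRing C ε) D) (a : CurveRing C) (d : D) :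
    σ (algebraMap _ (RootRing C ε) a ⊗ₜ d) = algebraMap _ (RootRing C ε) a ⊗ₜ d :=
  hσ.2 (a ⊗ₜ d)

/-- An ID-automorphism multiplies both generators by the same square root of `1` in `D`. -/
lemma exists_idGal_apply {σ : (RootRing C ε ⊗[C] D) ≃ₐ[C] (RootRing C ε ⊗[C] D)}
    (hσ : σ ∈ idGal C (CurveRing C) (RootRing C ε) D) :
    ∃ d : D, d ^ 2 = 1 ∧ σ (rootElt C ε ⊗ₜ 1) = rootElt C ε ⊗ₜ d ∧
      σ (corootElt C ε ⊗ₜ 1) = corootElt C ε ⊗ₜ d := by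
  let j : CurveRing C →+* RootRing C ε ⊗[C] D :=
    (Algebra.TensorProduct.includeLeftRingHom).comp (algebraMap (CurveRing C) (RootRing C ε))
  have hj : ∀ a, j a = algebraMap (CurveRing C) (RootRing C ε) a ⊗ₜ[C] (1 : D) := fun _ => rfl
  have hσj : ∀ a, σ (j a) = j a := fun a => idGal_fix_algebraMap hσ a 1
  have hθj : ∀ a, baseθ C (RootRing C ε) D 1 (j a) = j (deriv C a) := fun a => by
    rw [hj, baseθ_tmul, θ_one_rootRing_algebraMap, hj]
  set y₀ : RootRing C ε ⊗[C] D := rootElt C ε ⊗ₜ 1 with hy₀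
  set z₀ : RootRing C ε ⊗[C] D := corootElt C ε ⊗ₜ 1 with hz₀
  have hy : y₀ ^ 2 = j ε * j (s C) := by
    rw [hy₀, Algebra.TensorProduct.tmul_pow, rootElt_sq, one_pow, ← hj, map_mul]
  have hyz : y₀ * z₀ = j (t C) := by
    rw [hy₀, hz₀, Algebra.TensorProduct.tmul_mul_tmul, rootElt_mul_corootElt, one_mul, hj]
  have hz : z₀ ^ 2 = j ε * (j (s C) ^ 2 - 1) := by
    rw [hz₀, Algebra.TensorProduct.tmul_pow, corootElt_sq, one_pow, ← hj, map_mul, map_sub,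
      map_pow, map_one]
  have hdy : baseθ C (RootRing C ε) D 1 y₀ = j ε * j (w C) * z₀ := by
    rw [hy₀, baseθ_tmul, θ_one_rootElt, ← map_mul, hj, hz₀, Algebra.TensorProduct.tmul_mul_tmul,
      one_mul]
  have hdz : baseθ C (RootRing C ε) D 1 z₀ = 2 * j ε * j (w C) * j (s C) * y₀ := by
    rw [hz₀, baseθ_tmul, θ_one_corootElt, ← map_ofNat j 2, ← map_mul, ← map_mul, ← map_mul, hj,
      hy₀, Algebra.TensorProduct.tmul_mul_tmul, one_mul]
  have hε : j ε ^ 2 = 1 := by rw [← map_pow, units_sq, map_one]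
  have hty : j (t C) * y₀ = j ε * j (s C) * z₀ := by linear_combination - y₀ * hyz + z₀ * hy
  have htz : j (t C) * z₀ = j ε * (j (s C) ^ 2 - 1) * y₀ := by
    linear_combination - z₀ * hyz + y₀ * hz
  set y := σ y₀ with hy'
  set z := σ z₀ with hz'
  have hty' : j (t C) * y = j ε * j (s C) * z := by
    simpa only [map_mul, hσj] using congrArg σ hty
  have htz' : j (t C) * z = j ε * (j (s C) ^ 2 - 1) * y := by
    simpa only [map_mul, map_sub, map_pow, map_one, hσj] using congrArg σ htz
  have hdy' : baseθ C (RootRing C ε) D 1 y = j ε * j (w C) * z := by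
    rw [hy', ← hσ.1, hdy, map_mul, map_mul, hσj, hσj]
  have hdz' : baseθ C (RootRing C ε) D 1 z = 2 * j ε * j (w C) * j (s C) * y := by
    rw [hz', ← hσ.1, hdz]
    simp only [map_mul, hσj, map_ofNat, ← hy']
  have hdε : deriv C ((ε : ℤ) : CurveRing C) = 0 := Derivation.map_intCast _ _
  -- Polarising `ε s y₀² - ε z₀² = 1` gives the candidate for the factor. It is what `d` must be if
  -- `y = y₀ d` and `z = z₀ d`, and its derivative vanishes by the relations for both pairs.
  obtain ⟨d, hd⟩ := exists_eq_one_tmul_of_baseθ_one_eq_zero (C := C) (R := RootRing C ε) (D := D)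
    (x := j ε * j (s C) * y₀ * y - j ε * z₀ * z) (fun r hr =>
      ⟨constCoeff (r : Expansion C ε), Subtype.ext
        (eq_algebraMap_of_θ_one_eq_zero C ε (congrArg Subtype.val hr)).symm⟩) (by
      simp only [map_sub, baseθ_one_mul, hθj, hdε, hdy, hdz, hdy', hdz', deriv_s, map_mul,
        map_ofNat, map_zero]
      linear_combination (j ε * j (w C) * y) * hty + (j ε * j (w C) * y₀) * hty')
  have hyd : y = y₀ * (1 ⊗ₜ d) := by
    rw [← hd]
    linear_combination (-j ε * j (s C) * y) * hy + j ε * z * hyz + j ε * htz' - y * hε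
  have hzd : z = z₀ * (1 ⊗ₜ d) := by
    rw [← hd]
    linear_combination (-j ε * j (s C) * y) * hyz + j ε * z * hz - j ε * j (s C) * hty' - z * hε
  refine ⟨d, ?_, ?_, ?_⟩
  · have h1 : j ε * j (s C) * y₀ ^ 2 - j ε * z₀ ^ 2 = 1 := by
      linear_combination j ε * j (s C) * hy - j ε * hz + hε
    have h2 : j ε * j (s C) * y ^ 2 - j ε * z ^ 2 = 1 := by
      simpa only [map_mul, map_sub, map_pow, map_one, hσj] using congrArg σ h1
    have h3 : (1 : RootRing C ε ⊗[C] D) = 1 ⊗ₜ (d ^ 2) := by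
      have : (1 : RootRing C ε) ⊗ₜ[C] (d ^ 2) = (1 ⊗ₜ d) ^ 2 := by
        rw [Algebra.TensorProduct.tmul_pow, one_pow]
      rw [this, ← h2, hyd, hzd]
      linear_combination (1 ⊗ₜ d) ^ 2 * h1
    -- Evaluation at `t = 0` carries the equation from `R ⊗ D` back to `D`.
    have h4 := congrArg (baseEval C ε D) h3
    rw [baseEval_one_tmul, map_one] at h4
    exact h4.symm
  · rw [hyd, hy₀, Algebra.TensorProduct.tmul_mul_tmul, mul_one, one_mul]
  · rw [hzd, hz₀, Algebra.TensorProduct.tmul_mul_tmul, mul_one, one_mul]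

end Expansion

/-! ### The isomorphism with `μ₂` and the comparison of `R₁` with `R₋₁` -/

namespace Expansion

open CurveRing

variable {C : Type u} [Field C] [CharZero C] {ε : ℤˣ} {D : Type*} [CommRing D] [Algebra C D]

/-- An ID-automorphism is determined by its values at `√(ε s)` and `t/√(ε s)`. -/
lemma idGal_ext {σ τ : (RootRing C ε ⊗[C] D) ≃ₐ[C] (RootRing C ε ⊗[C] D)}
    (hσ : σ ∈ idGal C (CurveRing C) (RootRing C ε) D)
    (hτ : τ ∈ idGal C (CurveRing C) (RootRing C ε) D)
    (hy : σ (rootElt C ε ⊗ₜ 1) = τ (rootElt C ε ⊗ₜ 1))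
    (hz : σ (corootElt C ε ⊗ₜ 1) = τ (corootElt C ε ⊗ₜ 1)) : σ = τ := by
  refine AlgEquiv.ext fun x => ?_
  induction x using TensorProduct.induction_on with
  | zero => rw [map_zero, map_zero]
  | add x x' hx hx' => rw [map_add, map_add, hx, hx']
  | tmul r d =>
    obtain ⟨a, b, c, rfl⟩ := exists_rootRing_eq C ε r
    have h : (algebraMap _ (RootRing C ε) a + algebraMap _ _ b * rootElt C ε
        + algebraMap _ _ c * corootElt C ε) ⊗ₜ[C] d
        = algebraMap _ (RootRing C ε) a ⊗ₜ d
          + algebraMap _ (RootRing C ε) b ⊗ₜ d * rootElt C ε ⊗ₜ 1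
          + algebraMap _ (RootRing C ε) c ⊗ₜ d * corootElt C ε ⊗ₜ 1 := by
      simp only [TensorProduct.add_tmul, Algebra.TensorProduct.tmul_mul_tmul, mul_one]
    rw [h]
    simp only [map_add, map_mul, idGal_fix_algebraMap hσ, idGal_fix_algebraMap hτ, hy, hz]

variable (C ε) in
/-- The coaction `r ↦ r₀ ⊗ 1 + r₁ ⊗ d` of a square root `d` of `1`, where `r₀` and `r₁` are
the even and the odd part of `r`. -/
def coaction (d : D) (hd : d ^ 2 = 1) : RootRing C ε →ₐ[C] RootRing C ε ⊗[C] D where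
  toFun r := evenPart C ε r ⊗ₜ 1 + (r - evenPart C ε r) ⊗ₜ d
  map_one' := by
    have h := evenPart_algebraMap C ε 1
    rw [map_one] at h
    rw [h, sub_self, TensorProduct.zero_tmul, add_zero, Algebra.TensorProduct.one_def]
  map_zero' := by simp
  map_add' x y := by
    simp only [map_add, TensorProduct.add_tmul, TensorProduct.sub_tmul]
    abel
  map_mul' x y := by
    have h : x * y - evenPart C ε (x * y) = evenPart C ε x * (y - evenPart C ε y)
        + (x - evenPart C ε x) * evenPart C ε y := by
      rw [evenPart_mul]; ring
    rw [h, evenPart_mul]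
    simp only [add_mul, mul_add, Algebra.TensorProduct.tmul_mul_tmul, TensorProduct.add_tmul,
      one_mul, mul_one, ← pow_two d, hd]
    abel
  commutes' c := by
    have h := evenPart_algebraMap C ε (algebraMap C _ c)
    rw [← IsScalarTower.algebraMap_apply] at h
    rw [h, sub_self, TensorProduct.zero_tmul, add_zero, Algebra.TensorProduct.algebraMap_apply]

variable (C ε) in
/-- The endomorphism `r ⊗ d' ↦ r₀ ⊗ d' + r₁ ⊗ d d'` of `R ⊗ D`. -/
def twistHom (d : D) (hd : d ^ 2 = 1) : RootRing C ε ⊗[C] D →ₐ[C] RootRing C ε ⊗[C] D :=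
  Algebra.TensorProduct.lift (coaction C ε d hd) Algebra.TensorProduct.includeRight
    (fun _ _ => mul_comm _ _)

lemma twistHom_tmul (d : D) (hd : d ^ 2 = 1) (r : RootRing C ε) (d' : D) :
    twistHom C ε d hd (r ⊗ₜ d')
      = evenPart C ε r ⊗ₜ d' + (r - evenPart C ε r) ⊗ₜ (d * d') := by
  refine (Algebra.TensorProduct.lift_tmul _ _ _ _ _).trans ?_
  change (evenPart C ε r ⊗ₜ[C] (1 : D) + (r - evenPart C ε r) ⊗ₜ[C] d) * (1 ⊗ₜ[C] d') = _
  simp only [add_mul, Algebra.TensorProduct.tmul_mul_tmul, mul_one, one_mul]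

/-- The odd part is multiplied by `d² = 1`, so the twist is its own inverse. -/
lemma twistHom_twistHom (d : D) (hd : d ^ 2 = 1) (x : RootRing C ε ⊗[C] D) :
    twistHom C ε d hd (twistHom C ε d hd x) = x := by
  induction x using TensorProduct.induction_on with
  | zero => simp only [map_zero]
  | add x y hx hy => simp only [map_add, hx, hy]
  | tmul r d' =>
    rw [twistHom_tmul, map_add, twistHom_tmul, twistHom_tmul, map_sub, evenPart_evenPart, sub_self,
      TensorProduct.zero_tmul, add_zero, zero_add, sub_zero, ← mul_assoc,
      ← pow_two, hd, one_mul, ← TensorProduct.add_tmul, add_sub_cancel]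

variable (C ε) in
/-- The automorphism of `R ⊗ D` attached to a square root of `1` in `D`. -/
def twist (d : D) (hd : d ^ 2 = 1) : idGal C (CurveRing C) (RootRing C ε) D :=
  ⟨AlgEquiv.ofAlgHom (twistHom C ε d hd) (twistHom C ε d hd)
      (AlgHom.ext (twistHom_twistHom d hd)) (AlgHom.ext (twistHom_twistHom d hd)), by
    constructor
    · intro n x
      change twistHom C ε d hd _ = baseθ C _ D n (twistHom C ε d hd x)
      induction x using TensorProduct.induction_on with
      | zero => simp only [map_zero]
      | add x y hx hy => simp only [map_add, hx, hy]
      | tmul r d' =>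
        rw [twistHom_tmul, baseθ_tmul, twistHom_tmul, map_add, baseθ_tmul, baseθ_tmul, evenPart_θ,
          map_sub]
    · intro x
      change twistHom C ε d hd _ = _
      induction x using TensorProduct.induction_on with
      | zero => simp only [map_zero]
      | add x y hx hy => simp only [map_add, hx, hy]
      | tmul a d' =>
        change twistHom C ε d hd (algebraMap _ _ a ⊗ₜ d') = algebraMap _ _ a ⊗ₜ d'
        rw [twistHom_tmul, evenPart_algebraMap, sub_self, TensorProduct.zero_tmul, add_zero]⟩

lemma twist_rootElt (d : D) (hd : d ^ 2 = 1) :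
    (twist C ε d hd).1 (rootElt C ε ⊗ₜ 1) = rootElt C ε ⊗ₜ d := by
  refine (twistHom_tmul d hd (rootElt C ε) 1).trans ?_
  rw [evenPart_rootElt, TensorProduct.zero_tmul, sub_zero, zero_add, mul_one]

/-- Evaluation at `t = 0`, where `y` has the value `1`, recovers the factor of `σ`. This formula
makes the factor multiplicative in `σ`. -/
lemma idGal_rootElt_tmul {σ : (RootRing C ε ⊗[C] D) ≃ₐ[C] (RootRing C ε ⊗[C] D)}
    (hσ : σ ∈ idGal C (CurveRing C) (RootRing C ε) D) (d : D) :
    σ (rootElt C ε ⊗ₜ d)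
      = rootElt C ε ⊗ₜ (baseEval C ε D (σ (rootElt C ε ⊗ₜ 1)) * d) := by
  obtain ⟨e, -, he, -⟩ := exists_idGal_apply hσ
  have h : (rootElt C ε ⊗ₜ d : RootRing C ε ⊗[C] D) = rootElt C ε ⊗ₜ 1 * 1 ⊗ₜ d := by
    rw [Algebra.TensorProduct.tmul_mul_tmul, mul_one, one_mul]
  rw [h, map_mul, idGal_fix hσ, he, baseEval_rootElt_tmul, Algebra.TensorProduct.tmul_mul_tmul,
    mul_one]

variable (C ε D) in
/-- The character `σ ↦ σ(√(ε s))/√(ε s)` of the Galois group. -/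
def idGalCharacter : idGal C (CurveRing C) (RootRing C ε) D →* rootsOfUnity 2 D where
  toFun σ := rootsOfUnity.mkOfPowEq (baseEval C ε D (σ.1 (rootElt C ε ⊗ₜ 1))) (by
    obtain ⟨d, hd, h, -⟩ := exists_idGal_apply σ.2
    rw [h, baseEval_rootElt_tmul, hd])
  map_one' := by
    refine Subtype.ext (Units.ext ?_)
    exact baseEval_rootElt_tmul C ε D 1
  map_mul' σ τ := by
    refine Subtype.ext (Units.ext ?_)
    change baseEval C ε D (σ.1 (τ.1 (rootElt C ε ⊗ₜ 1))) = baseEval C ε D (σ.1 (rootElt C ε ⊗ₜ 1))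
      * baseEval C ε D (τ.1 (rootElt C ε ⊗ₜ 1))
    rw [idGal_rootElt_tmul τ.2, mul_one, idGal_rootElt_tmul σ.2, baseEval_rootElt_tmul,
      baseEval_rootElt_tmul]

lemma coe_idGalCharacter (σ : idGal C (CurveRing C) (RootRing C ε) D) :
    ((idGalCharacter C ε D σ : Dˣ) : D) = baseEval C ε D (σ.1 (rootElt C ε ⊗ₜ 1)) := rfl

/-- Injective because `z` is scaled by the same factor as `y`; surjective because the twist by `ζ`
multiplies `y` by `ζ`. -/
lemma idGalCharacter_bijective : Function.Bijective (idGalCharacter C ε D) := by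
  constructor
  · intro σ τ h
    have h' := congrArg (fun x : rootsOfUnity 2 D => ((x : Dˣ) : D)) h
    simp only [coe_idGalCharacter] at h'
    obtain ⟨d, -, hd, hd'⟩ := exists_idGal_apply σ.2
    obtain ⟨e, -, he, he'⟩ := exists_idGal_apply τ.2
    rw [hd, he, baseEval_rootElt_tmul, baseEval_rootElt_tmul] at h'
    subst h'
    exact Subtype.ext (idGal_ext σ.2 τ.2 (hd.trans he.symm) (hd'.trans he'.symm))
  · intro ζ
    have hζ : ((ζ : Dˣ) : D) ^ 2 = 1 := by
      rw [← Units.val_pow_eq_pow_val, (mem_rootsOfUnity 2 _).1 ζ.2, Units.val_one]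
    refine ⟨twist C ε _ hζ, Subtype.ext (Units.ext ?_)⟩
    rw [coe_idGalCharacter, twist_rootElt, baseEval_rootElt_tmul]

variable (C ε) in
lemma galIsoMu_rootRing : GalIsoMu C (CurveRing C) (rootRing C ε).toSubalgebra 2 := by
  refine ⟨fun D _ _ => MulEquiv.ofBijective (idGalCharacter C ε D) idGalCharacter_bijective, ?_⟩
  intro D D' _ _ _ _ φ σ
  refine Subtype.ext (Units.ext ?_)
  change baseEval C ε D' (extendScalars φ σ.1 (rootElt C ε ⊗ₜ 1))
    = φ (baseEval C ε D (σ.1 (rootElt C ε ⊗ₜ 1)))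
  obtain ⟨d, -, hd, -⟩ := exists_idGal_apply σ.2
  rw [extendScalars_tmul, hd, Algebra.TensorProduct.map_tmul, Algebra.TensorProduct.tmul_mul_tmul,
    AlgHom.id_apply, mul_one, mul_one, baseEval_rootElt_tmul, baseEval_rootElt_tmul]

variable (C) in
-- An isomorphism carries `√s` to an element of `R₋₁` whose square is `s`. At the point `(-1, 0)`
-- the value of `s` is `-1`, so the value of that element is a square root of `-1` in `C`.
lemma isEmpty_rootRing_algEquiv (h : ¬ IsSquare (-1 : C)) :
    IsEmpty ((rootRing C 1).toSubalgebra ≃ₐ[CurveRing C] (rootRing C (-1)).toSubalgebra) := by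
  refine ⟨fun f => h ⟨rootRingEval C (-1) (f (rootElt C 1)), ?_⟩⟩
  have h1 := congrArg (rootRingEval C (-1)) (congrArg f (rootElt_sq C 1))
  rw [map_pow, map_pow, AlgEquiv.commutes, rootRingEval_apply (x := algebraMap _ _ _),
    coe_rootRing_algebraMap, constCoeff_algebraMap, map_mul, map_intCast, evalPoint_s] at h1
  rw [← pow_two, h1]
  simp

end Expansion

end

theorem mainTheorem4 (C : Type u) [Field C] [CharZero C] :
    -- the constants of `S` are `C`, and the maps `S → C[[t]]` are embeddings
    IDRing.constants (CurveRing C) = (algebraMap C (CurveRing C)).range ∧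
    (∀ ε : ℤˣ, Function.Injective (algebraMap (CurveRing C) (Expansion C ε))) ∧
    -- `y 1 = √s`, `y (-1) = √(-s)`, and `R 1`, `R (-1)` are the rings `R`, `R₂`
    ∃ (y : ∀ ε : ℤˣ, Expansion C ε)
      (R : ∀ ε : ℤˣ, IDSubalgebra (CurveRing C) (Expansion C ε)),
      (∀ ε : ℤˣ,
        y ε ^ 2 = algebraMap (CurveRing C) (Expansion C ε) (((ε : ℤ) : CurveRing C) * CurveRing.s C) ∧
        Expansion.constCoeff (y ε) = 1 ∧
        (R ε).toSubalgebra = Algebra.adjoin (CurveRing C)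
          {y ε, algebraMap (CurveRing C) (Expansion C ε) (CurveRing.t C) * (y ε)⁻¹} ∧
        -- `R ε` is the unique Picard-Vessiot ring for `M` inside `C[[t]]`
        (∀ R' : IDSubalgebra (CurveRing C) (Expansion C ε),
          IsPicardVessiotRing (CurveRing C)
            (NonFreeModule (-3 * CurveRing.s C * CurveRing.t C * CurveRing.w C)) R'.toSubalgebra
          ↔ R' = R ε) ∧
        -- it is an extension of degree `2` with Galois group `μ₂`
        Module.Finite (CurveRing C) (R ε).toSubalgebra ∧
        Module.finrank (CurveRing C) (R ε).toSubalgebra = 2 ∧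
        GalIsoMu C (CurveRing C) (R ε).toSubalgebra 2) ∧
      (¬ IsSquare (-1 : C) →
        IsEmpty ((R 1).toSubalgebra ≃ₐ[CurveRing C] (R (-1)).toSubalgebra)) := by
  refine ⟨CurveRing.constants_eq C, Expansion.algebraMap_injective C, Expansion.root C,
    Expansion.rootRing C, fun ε => ⟨Expansion.root_sq C ε, Expansion.constCoeff_root C ε, rfl,
      Expansion.isPicardVessiotRing_iff C ε, Expansion.finite_rootRing C ε,
      Expansion.finrank_rootRing C ε, Expansion.galIsoMu_rootRing C ε⟩,
    Expansion.isEmpty_rootRing_algEquiv C⟩
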